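/- Let $\chi\ge 1$ and $n\ge 0$ be integers such that $3\chi-n$ is a non-negative even integer; call such a pair $(\chi,n)$ admissible. Take interior vertices $v_1,\dots,v_\chi$, where three half-edges labelled $3i-2,3i-1,3i$ emanate from $v_i$, and boundary vertices $w_1,\dots,w_n$, where one half-edge labelled $3\chi+j$ emanates from $w_j$. A good partition is a partition of $\{1,\dots,3\chi+n\}$ into pairs such that every pair contains at least one label $\le 3\chi$. Let $\mathcal F_{\chi,n}$ be the set of good partitions, with the uniform probability measure $\mathrm{Prob}_{\chi,n}$. Gluing the two half-edges of each pair turns $P\in\mathcal F_{\chi,n}$ into a multigraph $G=G(P)$ (loops and multiple edges are allowed) with $\chi$ vertices of degree $3$ and $n$ vertices of degree $1$. Its Laplacian acts on functions $f:V(G)\to\mathbb R$ by $$\Delta_G f(v)=\frac1{\deg v}\sum_{w\sim v}\bigl(f(w)-f(v)\bigr),$$ where the sum runs over the edges joining $v$ to $w$, counted with multiplicity, and $\lambda_0(G)\le\lambda_1(G)\le\cdots$ denote the eigenvalues of $-\Delta_G$, repeated according to multiplicity, so that $\lambda_0(G)=0$. **Theorem.** Let $n:\mathbb N\to\mathbb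 N$, and let $\chi$ range over those integers for which $(\chi,n(\chi))$ is admissible. Assume $n(\chi)=o(\chi^{2/3})$ as $\chi\to\infty$. Then for every constant $0\le\mu<0.02$, $$\lim_{\chi\to\infty}\mathrm{Prob}_{\chi,n(\chi)}\Bigl(G\text{ is connected and }\lambda_1(G)\ge\tfrac1{18}\mu^2\Bigr)=1.$$ -/

import Mathlib

open Filter Topology Asymptotics

namespace CubicBoundary

/-- The vertices: `Sum.inl i` is the `i`-th interior vertex (degree 3), `Sum.inr j` is the `j`-th
boundary vertex (degree 1). -/
abbrev Vertex (χ n : ℕ) : Type := Fin χ ⊕ Fin n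

/-- The `3χ + n` half-edges: `Sum.inl (i, k)`, `k = 0, 1, 2`, are the three half-edges emanating
from the `i`-th interior vertex (the labels `1, …, 3χ`), and `Sum.inr j` is the half-edge emanating
from the `j`-th boundary vertex (the labels `3χ + 1, …, 3χ + n`). -/
abbrev HalfEdge (χ n : ℕ) : Type := (Fin χ × Fin 3) ⊕ Fin n

/-- The vertex from which a half-edge emanates. -/
def HalfEdge.vertex {χ n : ℕ} : HalfEdge χ n → Vertex χ n :=
  Sum.map Prod.fst id

/-- The pairs `(χ, n)` for which the model is considered: `χ ≥ 1` and `3χ - n` is a non-negative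
even integer. -/
def Admissible (χ n : ℕ) : Prop :=
  1 ≤ χ ∧ n ≤ 3 * χ ∧ Even (3 * χ - n)

/-- A partition of the set of half-edges is good if it is a partition into pairs and every pair
contains at least one half-edge of an interior vertex. -/
def IsGood {χ n : ℕ} (P : Finpartition (Finset.univ : Finset (HalfEdge χ n))) : Prop :=
  ∀ e ∈ P.parts, e.card = 2 ∧ ∃ h ∈ e, h.isLeft = true

/-- The set `𝓕_{χ,n}` of good partitions. -/
abbrev GoodPartition (χ n : ℕ) : Type :=
  {P : Finpartition (Finset.univ : Finset (HalfEdge χ n)) // IsGood P}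

/-- The degree of a vertex: the number of half-edges emanating from it (so a loop counts twice). -/
def degree {χ n : ℕ} (v : Vertex χ n) : ℕ :=
  (Finset.univ.filter fun h : HalfEdge χ n => h.vertex = v).card

/-- The adjacency matrix of the multigraph `G(P)` obtained by gluing the two half-edges of each
pair: for `v ≠ w` this is the number of edges joining `v` and `w`; for `v = w` it is twice the
number of loops at `v`. -/
def edgeCount {χ n : ℕ} (P : GoodPartition χ n) (v w : Vertex χ n) : ℕ :=
  (Finset.univ.filter fun p : HalfEdge χ n × HalfEdge χ n =>
    p.1.vertex = v ∧ p.2.vertex = w ∧ {p.1, p.2} ∈ P.1.parts).card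

/-- The simple graph underlying `G(P)`: loops and multiplicities of edges are forgotten. -/
def underlyingGraph {χ n : ℕ} (P : GoodPartition χ n) : SimpleGraph (Vertex χ n) :=
  SimpleGraph.fromRel fun v w => 0 < edgeCount P v w

/-- `G(P)` is connected. -/
def IsConnected {χ n : ℕ} (P : GoodPartition χ n) : Prop :=
  (underlyingGraph P).Connected

/-- The Laplacian of `G(P)`: `(Δ f)(v) = (1 / deg v) ∑_{w ∼ v} (f w - f v)`, the sum being over the
edges at `v`, with multiplicity. -/
noncomputable def laplacian {χ n : ℕ} (P : GoodPartition χ n) :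
    (Vertex χ n → ℝ) →ₗ[ℝ] (Vertex χ n → ℝ) where
  toFun f v := 1 / (degree v : ℝ) * ∑ w, (edgeCount P v w : ℝ) * (f w - f v)
  map_add' f g := by
    funext v
    simp only [Pi.add_apply, ← mul_add, ← Finset.sum_add_distrib]
    congr 1
    exact Finset.sum_congr rfl fun w _ => by ring
  map_smul' c f := by
    funext v
    simp only [Pi.smul_apply, smul_eq_mul, RingHom.id_apply, Finset.mul_sum]
    exact Finset.sum_congr rfl fun w _ => by ring

/-- The eigenvalues `λ₀ ≤ λ₁ ≤ …` of `-Δ` in increasing order, repeated according to multiplicity.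
(`-Δ` is symmetric for the inner product weighted by the degrees, so this list has `χ + n`
entries.) -/
noncomputable def eigenvalueList {χ n : ℕ} (P : GoodPartition χ n) : List ℝ :=
  (-laplacian P).charpoly.roots.sort (· ≤ ·)

/-- The first Laplacian eigenvalue `λ₁(G(P))`: the entry following the smallest one, `λ₀ = 0`.
(An admissible pair has `χ + n ≥ 2`, so the default value `0` is not used.) -/
noncomputable def lambdaOne {χ n : ℕ} (P : GoodPartition χ n) : ℝ :=
  (eigenvalueList P).getD 1 0

/-- The probability of a property of a uniformly random good partition. -/
noncomputable def Prob (χ n : ℕ) (Q : GoodPartition χ n → Prop) : ℝ :=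
  (Nat.card {P : GoodPartition χ n // Q P} : ℝ) / (Nat.card (GoodPartition χ n) : ℝ)

/-- The filter of `χ → ∞` along those `χ` for which `(χ, n(χ))` is admissible. -/
def admissibleAtTop (n : ℕ → ℕ) : Filter ℕ :=
  atTop ⊓ 𝓟 {χ | Admissible χ (n χ)}

end CubicBoundary

/-! ### Cheeger's inequality for weighted graphs -/

namespace CubicBoundary

/-! By Cheeger's inequality it is enough that, with probability tending to 1, every vertex set of at
most half the total volume has a cut of at least 1/150 of its volume. This forces connectedness and
λ₁ ≥ (1/150)²/2, which is exactly 0.02²/18 (`cheeger`, `isConnected_and_le_lambdaOne`).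

Boundary vertices are eliminated in `expands_of_forall_cutSet`: only sets A of interior vertices
matter. If A has a vertices, b half-edges glued to leaves and e half-edges glued to interior
half-edges outside A, the requirement is 3a + b ≤ 150e. A violation with b ≤ 2a has 30e < a. A
violation with b > 2a contains a vertex carrying three leaves, and the expected number of these is
at most n³/χ², which tends to 0 by the growth hypothesis.

The remaining violations are excluded by a first moment bound. Permutations of the interior
half-edges preserve the uniform measure, so a fixed set of k half-edges may be replaced by a random
one while the partition stays fixed. A set H is then determined by its leaf-glued half-edges, its
inner pairs and its cut half-edges, so products of binomial coefficients bound the count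
(`choose_mul_card_le`, `prob_hasCut_le`). For a ≤ δχ these bounds are summed over a by dominated
convergence (`cutBound_pow_le_of_small`). For larger a, comparison with binomial distributions of
parameter a/χ gives exponential decay in a, up to polynomial factors and a factor 2ⁿ that is
harmless for n = o(χ) (`cutBound_sq_le_of_large`). -/

theorem exists_weighted_median {V : Type*} [Fintype V] [Nonempty V] (d : V → ℝ) (hd : ∀ v, 0 ≤ d v)
    (f : V → ℝ) :
    ∃ c, 2 * ∑ v with c < f v, d v ≤ ∑ v, d v ∧ 2 * ∑ v with f v < c, d v ≤ ∑ v, d v := by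
  -- The median is the least value of f whose strict superlevel set has at most half the mass.
  set T := Finset.univ.filter fun x => 2 * ∑ v with f x < f v, d v ≤ ∑ v, d v with hT
  have hTne : T.Nonempty := by
    obtain ⟨x, -, hx⟩ := Finset.univ.exists_max_image f (Finset.univ_nonempty (α := V))
    refine ⟨x, ?_⟩
    simp only [hT, Finset.mem_filter, Finset.mem_univ, true_and]
    rw [Finset.filter_false_of_mem fun v _ => not_lt.mpr (hx v (Finset.mem_univ v))]
    simpa using Finset.sum_nonneg fun v _ => hd v
  obtain ⟨x, hxT, hx⟩ := T.exists_min_image f hTne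
  refine ⟨f x, (Finset.mem_filter.1 hxT).2, ?_⟩
  rcases (Finset.univ.filter fun v => f v < f x).eq_empty_or_nonempty with he | hne
  · rw [he]; simpa using Finset.sum_nonneg fun v _ => hd v
  · obtain ⟨y, hy, hymax⟩ := Finset.exists_max_image _ f hne
    have hyx : f y < f x := (Finset.mem_filter.1 hy).2
    have hyT : y ∉ T := fun hyT => not_lt.mpr (hx y hyT) hyx
    have hlt : ∑ v, d v < 2 * ∑ v with f y < f v, d v := by simpa [hT] using hyT
    have hle : ∑ v with f y < f v, d v ≤ ∑ v with ¬ f v < f x, d v := by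
      refine Finset.sum_le_sum_of_subset_of_nonneg (fun v hv => ?_) fun v _ _ => hd v
      simp only [Finset.mem_filter, Finset.mem_univ, true_and] at hv ⊢
      exact fun hvx => not_lt.mpr (hymax v (by simpa using hvx)) hv
    have hsplit := Finset.sum_filter_add_sum_filter_not Finset.univ (fun v => f v < f x) d
    linarith

section Cheeger

variable {V : Type*} [Fintype V] [DecidableEq V]

/-- The weighted degree of a vertex. -/
def wdeg (w : V → V → ℝ) (v : V) : ℝ := ∑ u, w v u

/-- The total weight of the edges leaving `S`. -/
def wcut (w : V → V → ℝ) (S : Finset V) : ℝ := ∑ v ∈ S, ∑ u ∈ Sᶜ, w v u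

/-- Every set of at most half the total volume has isoperimetric ratio at least `h`. -/
def Expands (w : V → V → ℝ) (h : ℝ) : Prop :=
  ∀ S : Finset V, 2 * ∑ v ∈ S, wdeg w v ≤ ∑ v, wdeg w v → h * ∑ v ∈ S, wdeg w v ≤ wcut w S

variable {w : V → V → ℝ} {h : ℝ}

/-- The sum runs over ordered pairs, so each cut edge is seen from both ends. -/
theorem sum_indicator_variation (hsymm : ∀ u v, w u v = w v u) (S : Finset V) :
    ∑ v, ∑ u, w v u * |(if v ∈ S then (1 : ℝ) else 0) - (if u ∈ S then 1 else 0)|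
      = 2 * wcut w S := by
  have h1 : ∑ v, ∑ u, w v u * |(if v ∈ S then (1 : ℝ) else 0) - (if u ∈ S then 1 else 0)|
      = ∑ v, ∑ u, ((if v ∈ S then if u ∈ Sᶜ then w v u else 0 else 0)
        + (if u ∈ S then if v ∈ Sᶜ then w u v else 0 else 0)) := by
    refine Finset.sum_congr rfl fun v _ => Finset.sum_congr rfl fun u _ => ?_
    rw [hsymm u v]
    by_cases hv : v ∈ S <;> by_cases hu : u ∈ S <;> simp [hu, hv]
  have h2 : ∑ v, ∑ u, (if v ∈ S then if u ∈ Sᶜ then w v u else 0 else 0) = wcut w S := by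
    simp only [wcut, Finset.sum_ite_irrel, Finset.sum_const_zero, Finset.sum_ite_mem,
      Finset.univ_inter]
  rw [h1]
  simp only [Finset.sum_add_distrib]
  rw [h2, Finset.sum_comm, h2]; ring

/-- A discrete coarea formula. Subtracting from g its least positive value on its support S strictly
shrinks the support, and both sides drop by multiples of the volume and the cut of S, which the
expansion hypothesis compares. -/
theorem two_mul_le_sum_variation (hsymm : ∀ u v, w u v = w v u) (hw : ∀ u v, 0 ≤ w u v)
    (hexp : Expands w h) (g : V → ℝ) (hg : ∀ v, 0 ≤ g v)
    (hsupp : 2 * ∑ v with 0 < g v, wdeg w v ≤ ∑ v, wdeg w v) :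
    2 * h * ∑ v, wdeg w v * g v ≤ ∑ v, ∑ u, w v u * |g v - g u| := by
  induction hk : (Finset.univ.filter fun v => 0 < g v).card using Nat.strong_induction_on
    generalizing g with
  | _ k ih =>
    set S := Finset.univ.filter fun v => 0 < g v with hS
    have hmem : ∀ v, v ∈ S ↔ 0 < g v := fun v => by simp [hS]
    rcases S.eq_empty_or_nonempty with hemp | hne
    · have h0 : ∀ v, g v = 0 := fun v => le_antisymm (not_lt.mp fun hlt => by
        simpa [hemp] using (hmem v).2 hlt) (hg v)
      simp [h0]
    · obtain ⟨x, hx, hmin⟩ := S.exists_min_image g hne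
      have hcpos : 0 < g x := (hmem x).1 hx
      set c := g x
      set g' : V → ℝ := fun v => if v ∈ S then g v - c else 0 with hg'
      have hgdecomp : ∀ v, g v = g' v + c * (if v ∈ S then 1 else 0) := fun v => by
        by_cases hv : v ∈ S
        · simp [hg', hv]
        · have : g v = 0 := le_antisymm (not_lt.mp fun hlt => hv ((hmem v).2 hlt)) (hg v)
          simp [hg', hv, this]
      have hg'0 : ∀ v, 0 ≤ g' v := fun v => by
        by_cases hv : v ∈ S
        · simpa [hg', hv] using hmin v hv
        · simp [hg', hv]
      have hsub : (Finset.univ.filter fun v => 0 < g' v) ⊂ S := by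
        refine (Finset.ssubset_iff_of_subset fun v hv => ?_).2 ⟨x, hx, by simp [hg', hx, c]⟩
        by_contra hvS
        simp [hg', hvS] at hv
      have hwdeg : ∀ v, 0 ≤ wdeg w v := fun v => Finset.sum_nonneg fun u _ => hw v u
      have hrec := ih _ (hk ▸ Finset.card_lt_card hsub) g' hg'0
        (le_trans (mul_le_mul_of_nonneg_left
          (Finset.sum_le_sum_of_subset_of_nonneg hsub.1 fun v _ _ => hwdeg v) zero_le_two) hsupp) rfl
      have hSexp := hexp S hsupp
      have hleft : ∑ v, wdeg w v * g v = ∑ v, wdeg w v * g' v + c * ∑ v ∈ S, wdeg w v := by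
        rw [Finset.mul_sum, ← Finset.univ_inter S, ← Finset.sum_ite_mem, ← Finset.sum_add_distrib]
        refine Finset.sum_congr rfl fun v _ => ?_
        rw [hgdecomp v]
        split_ifs <;> ring
      have hright : ∑ v, ∑ u, w v u * |g v - g u| = ∑ v, ∑ u, w v u * |g' v - g' u|
          + c * ∑ v, ∑ u, w v u * |(if v ∈ S then (1 : ℝ) else 0) - (if u ∈ S then 1 else 0)| := by
        simp only [Finset.mul_sum, ← Finset.sum_add_distrib]
        refine Finset.sum_congr rfl fun v _ => Finset.sum_congr rfl fun u _ => ?_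
        have hv0 := hg'0 v
        have hu0 := hg'0 u
        have hz : ∀ z, z ∉ S → g' z = 0 := fun z hz => by simp [hg', hz]
        rw [hgdecomp v, hgdecomp u]
        by_cases hv : v ∈ S <;> by_cases hu : u ∈ S
        · simp [hu, hv]
        · simp only [hv, hu, hz u hu, if_true, if_false, mul_one, mul_zero, add_zero, sub_zero,
            abs_one]
          rw [abs_of_nonneg (by linarith), abs_of_nonneg hv0]; ring
        · simp only [hv, hu, hz v hv, if_true, if_false, mul_one, mul_zero, add_zero, zero_sub,
            abs_neg, abs_one]
          rw [abs_of_nonneg (by linarith), abs_of_nonneg hu0]; ring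
        · simp [hu, hv]
      rw [hleft, hright, sum_indicator_variation hsymm]
      nlinarith

/-- The coarea bound is applied to g². Factoring g(v)² - g(u)² and using Cauchy–Schwarz brings in
the energy and the sum of w(g(v) + g(u))², the latter being at most four times the weighted mass. -/
theorem sq_mul_le_energy_of_support (hsymm : ∀ u v, w u v = w v u) (hw : ∀ u v, 0 ≤ w u v)
    (hh : 0 ≤ h) (hexp : Expands w h) (g : V → ℝ) (hg : ∀ v, 0 ≤ g v)
    (hsupp : 2 * ∑ v with 0 < g v, wdeg w v ≤ ∑ v, wdeg w v) :
    h ^ 2 * ∑ v, wdeg w v * g v ^ 2 ≤ ∑ v, ∑ u, w v u * (g v - g u) ^ 2 := by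
  have hwdeg : ∀ v, 0 ≤ wdeg w v := fun v => Finset.sum_nonneg fun u _ => hw v u
  set X := ∑ v, wdeg w v * g v ^ 2 with hX
  set E := ∑ v, ∑ u, w v u * (g v - g u) ^ 2 with hE
  have hX0 : 0 ≤ X := Finset.sum_nonneg fun v _ => mul_nonneg (hwdeg v) (sq_nonneg _)
  have hE0 : 0 ≤ E := Finset.sum_nonneg fun v _ => Finset.sum_nonneg fun u _ =>
    mul_nonneg (hw v u) (sq_nonneg _)
  have hco := two_mul_le_sum_variation hsymm hw hexp (fun v => g v ^ 2) (fun v => sq_nonneg _) (by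
    have : ∀ v, 0 < g v ^ 2 ↔ 0 < g v := fun v =>
      ⟨fun hp => lt_of_le_of_ne (hg v) fun h0 => by simp [← h0] at hp, fun hp => by positivity⟩
    simpa only [this] using hsupp)
  set Y := ∑ v, ∑ u, w v u * |g v ^ 2 - g u ^ 2|
  have hsum : ∑ v, ∑ u, w v u * (g v + g u) ^ 2 ≤ 4 * X := by
    have h1 : ∑ v, ∑ u, w v u * g v ^ 2 = X := by
      simp only [hX, wdeg, Finset.sum_mul]
    have h2 : ∑ v, ∑ u, w v u * g u ^ 2 = X := by
      rw [Finset.sum_comm, ← h1]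
      exact Finset.sum_congr rfl fun v _ => Finset.sum_congr rfl fun u _ => by rw [hsymm]
    calc ∑ v, ∑ u, w v u * (g v + g u) ^ 2
        ≤ ∑ v, ∑ u, (2 * (w v u * g v ^ 2) + 2 * (w v u * g u ^ 2)) := by
          refine Finset.sum_le_sum fun v _ => Finset.sum_le_sum fun u _ => ?_
          nlinarith [mul_nonneg (hw v u) (sq_nonneg (g v - g u))]
      _ = 4 * X := by
          simp only [Finset.sum_add_distrib, ← Finset.mul_sum]
          rw [h1, h2]; ring
  have hCS : Y ^ 2 ≤ E * ∑ v, ∑ u, w v u * (g v + g u) ^ 2 := by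
    simp only [Y, hE, ← Finset.sum_product', Finset.univ_product_univ]
    refine Finset.sum_sq_le_sum_mul_sum_of_sq_le_mul _ (fun p _ => mul_nonneg (hw _ _) (sq_nonneg _))
      (fun p _ => mul_nonneg (hw _ _) (sq_nonneg _)) fun p _ => ?_
    rw [mul_pow, sq_abs]
    exact le_of_eq (by ring)
  have hY : (2 * h * X) ^ 2 ≤ E * (4 * X) :=
    ((pow_le_pow_left₀ (by positivity) hco 2).trans hCS).trans (by gcongr)
  rcases hX0.eq_or_lt with h0 | hpos
  · rw [← h0]; simpa using hE0
  · have : 4 * X * (h ^ 2 * X) ≤ 4 * X * E := by nlinarith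
    exact le_of_mul_le_mul_left this (by positivity)

/-- The difficult half of Cheeger's inequality. -/
theorem cheeger (hsymm : ∀ u v, w u v = w v u) (hw : ∀ u v, 0 ≤ w u v)
    (hh : 0 ≤ h) (hexp : Expands w h) (f : V → ℝ) (hf : ∑ v, wdeg w v * f v = 0) :
    h ^ 2 * ∑ v, wdeg w v * f v ^ 2 ≤ ∑ v, ∑ u, w v u * (f v - f u) ^ 2 := by
  cases isEmpty_or_nonempty V
  · simp
  have hwdeg : ∀ v, 0 ≤ wdeg w v := fun v => Finset.sum_nonneg fun u _ => hw v u
  -- Cutting at a median makes the positive and negative parts of f - c both supported on at most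
  -- half the volume.
  obtain ⟨c, hc1, hc2⟩ := exists_weighted_median (wdeg w) hwdeg f
  have hp := sq_mul_le_energy_of_support hsymm hw hh hexp (fun v => max (f v - c) 0)
    (fun v => le_max_right _ _) (by simpa using hc1)
  have hm := sq_mul_le_energy_of_support hsymm hw hh hexp (fun v => max (c - f v) 0)
    (fun v => le_max_right _ _) (by simpa using hc2)
  have henergy : ∑ v, ∑ u, w v u * (max (f v - c) 0 - max (f u - c) 0) ^ 2
      + ∑ v, ∑ u, w v u * (max (c - f v) 0 - max (c - f u) 0) ^ 2
      ≤ ∑ v, ∑ u, w v u * (f v - f u) ^ 2 := by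
    simp only [← Finset.sum_add_distrib, ← mul_add]
    refine Finset.sum_le_sum fun v _ => Finset.sum_le_sum fun u _ =>
      mul_le_mul_of_nonneg_left ?_ (hw v u)
    rcases le_total (f v) c with h1 | h1 <;> rcases le_total (f u) c with h2 | h2
    · rw [max_eq_right (by linarith : f v - c ≤ 0), max_eq_right (by linarith : f u - c ≤ 0),
        max_eq_left (by linarith : 0 ≤ c - f v), max_eq_left (by linarith : 0 ≤ c - f u)]
      nlinarith
    · rw [max_eq_right (by linarith : f v - c ≤ 0), max_eq_left (by linarith : 0 ≤ f u - c),
        max_eq_left (by linarith : 0 ≤ c - f v), max_eq_right (by linarith : c - f u ≤ 0)]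
      nlinarith
    · rw [max_eq_left (by linarith : 0 ≤ f v - c), max_eq_right (by linarith : f u - c ≤ 0),
        max_eq_right (by linarith : c - f v ≤ 0), max_eq_left (by linarith : 0 ≤ c - f u)]
      nlinarith
    · rw [max_eq_left (by linarith : 0 ≤ f v - c), max_eq_left (by linarith : 0 ≤ f u - c),
        max_eq_right (by linarith : c - f v ≤ 0), max_eq_right (by linarith : c - f u ≤ 0)]
      nlinarith
  -- Since f has weighted mean zero, shifting it by c can only increase its weighted mass.
  have hmass : ∑ v, wdeg w v * f v ^ 2 ≤ ∑ v, wdeg w v * max (f v - c) 0 ^ 2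
      + ∑ v, wdeg w v * max (c - f v) 0 ^ 2 := by
    have h1 : ∑ v, wdeg w v * max (f v - c) 0 ^ 2 + ∑ v, wdeg w v * max (c - f v) 0 ^ 2
        = ∑ v, wdeg w v * f v ^ 2 - 2 * c * ∑ v, wdeg w v * f v + c ^ 2 * ∑ v, wdeg w v := by
      simp only [Finset.mul_sum, ← Finset.sum_add_distrib, ← Finset.sum_sub_distrib]
      refine Finset.sum_congr rfl fun v _ => ?_
      rcases le_total (f v) c with h1 | h1
      · rw [max_eq_right (by linarith), max_eq_left (by linarith)]; ring
      · rw [max_eq_left (by linarith), max_eq_right (by linarith)]; ring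
    rw [h1, hf]
    nlinarith [mul_nonneg (sq_nonneg c) (Finset.sum_nonneg fun v (_ : v ∈ Finset.univ) => hwdeg v)]
  nlinarith [mul_le_mul_of_nonneg_left hmass (sq_nonneg h)]

end Cheeger

/-! ### From expansion to the second eigenvalue and connectedness -/

section Spectrum

variable {V : Type*} [Fintype V] [DecidableEq V]

/-- If a quadratic form is at least `t` on a hyperplane, then the second smallest eigenvalue is at
least `t`. -/
theorem le_sort_roots_getD_one {A : Matrix V V ℝ} (hA : A.IsHermitian) (hcard : 2 ≤ Fintype.card V)
    (x : V → ℝ) (t : ℝ)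
    (ht : ∀ y : V → ℝ, x ⬝ᵥ y = 0 → t * (y ⬝ᵥ y) ≤ y ⬝ᵥ A.mulVec y) :
    t ≤ (A.charpoly.roots.sort (· ≤ ·)).getD 1 0 := by
  have hroots := hA.roots_charpoly_eq_eigenvalues
  have huniq : ∀ i j, hA.eigenvalues i < t → hA.eigenvalues j < t → i = j := by
    intro i j hi hj
    by_contra hij
    set u : V → ℝ := ⇑(hA.eigenvectorBasis i) with hu
    set v : V → ℝ := ⇑(hA.eigenvectorBasis j) with hv
    have hAu : A.mulVec u = hA.eigenvalues i • u := hA.mulVec_eigenvectorBasis i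
    have hAv : A.mulVec v = hA.eigenvalues j • v := hA.mulVec_eigenvectorBasis j
    have horth := hA.eigenvectorBasis.orthonormal
    have hinner : ∀ k l, (⇑(hA.eigenvectorBasis k) : V → ℝ) ⬝ᵥ ⇑(hA.eigenvectorBasis l)
        = if k = l then 1 else 0 := fun k l => by
      have := orthonormal_iff_ite.1 horth l k
      rw [EuclideanSpace.inner_eq_star_dotProduct] at this
      simpa [eq_comm] using this
    have huu : u ⬝ᵥ u = 1 := by simpa using hinner i i
    have hvv : v ⬝ᵥ v = 1 := by simpa using hinner j j
    have huv : u ⬝ᵥ v = 0 := by simpa [hij] using hinner i j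
    have hvu : v ⬝ᵥ u = 0 := by rw [dotProduct_comm, huv]
    -- The plane spanned by two eigenvectors meets the hyperplane orthogonal to x. With both
    -- eigenvalues below t, such a vector violates the bound on the form.
    obtain ⟨α, β, hαβ, hx⟩ : ∃ α β : ℝ, 0 < α ^ 2 + β ^ 2 ∧ x ⬝ᵥ (α • u + β • v) = 0 := by
      by_cases h0 : x ⬝ᵥ u = 0
      · exact ⟨1, 0, by norm_num, by simp [h0]⟩
      · refine ⟨-(x ⬝ᵥ v), x ⬝ᵥ u, by positivity, ?_⟩
        simp only [dotProduct_add, dotProduct_smul, smul_eq_mul]; ring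
    have hbound := ht _ hx
    rw [Matrix.mulVec_add, Matrix.mulVec_smul, Matrix.mulVec_smul, hAu, hAv] at hbound
    simp only [dotProduct_add, add_dotProduct, dotProduct_smul, smul_dotProduct, smul_eq_mul, huu,
      hvv, huv, hvu] at hbound
    have h1 : 0 ≤ (t - hA.eigenvalues i) * α ^ 2 := by nlinarith [sq_nonneg α]
    have h2 : 0 ≤ (t - hA.eigenvalues j) * β ^ 2 := by nlinarith [sq_nonneg β]
    have h3 : (t - hA.eigenvalues i) * α ^ 2 = 0 := by nlinarith
    have h4 : (t - hA.eigenvalues j) * β ^ 2 = 0 := by nlinarith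
    have h5 : α ^ 2 = 0 := (mul_eq_zero.1 h3).resolve_left (by linarith)
    have h6 : β ^ 2 = 0 := (mul_eq_zero.1 h4).resolve_left (by linarith)
    linarith
  have hcount : A.charpoly.roots.countP (· < t) ≤ 1 := by
    rw [hroots, Multiset.countP_map]
    change (Finset.univ.filter fun i => _).card ≤ 1
    rw [Finset.card_le_one]
    intro i hi j hj
    exact huniq i j (by simpa using hi) (by simpa using hj)
  have hlen : (A.charpoly.roots.sort (· ≤ ·)).length = Fintype.card V := by
    rw [Multiset.length_sort, hroots]; simp
  have hsorted : (A.charpoly.roots.sort (· ≤ ·)).Pairwise (· ≤ ·) := Multiset.pairwise_sort _ _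
  have hcoe : ((A.charpoly.roots.sort (· ≤ ·) : List ℝ) : Multiset ℝ) = A.charpoly.roots :=
    Multiset.sort_eq _ _
  rw [← hcoe, Multiset.coe_countP] at hcount
  match hl : A.charpoly.roots.sort (· ≤ ·) with
  | [] => rw [hl] at hlen; simp at hlen; omega
  | [_] => rw [hl] at hlen; simp at hlen; omega
  | p :: q :: l =>
    rw [hl] at hcount hsorted
    by_contra! hlt
    simp only [List.getD_cons_succ, List.getD_cons_zero] at hlt
    have hpq : p ≤ q := by
      simp only [List.pairwise_cons] at hsorted
      exact hsorted.1 q (by simp)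
    rw [List.countP_cons_of_pos (by simpa using hpq.trans_lt hlt),
      List.countP_cons_of_pos (by simpa using hlt)] at hcount
    omega

end Spectrum

theorem sum_wdeg_sub_eq_energy {V : Type*} [Fintype V] {w : V → V → ℝ} (hsymm : ∀ u v, w u v = w v u) (f : V → ℝ) :
    ∑ v, wdeg w v * f v ^ 2 - ∑ v, ∑ u, w v u * (f v * f u)
      = 1 / 2 * ∑ v, ∑ u, w v u * (f v - f u) ^ 2 := by
  have h1 : ∑ v, ∑ u, w v u * f v ^ 2 = ∑ v, wdeg w v * f v ^ 2 := by
    simp only [wdeg, Finset.sum_mul]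
  have h2 : ∑ v, ∑ u, w v u * f u ^ 2 = ∑ v, wdeg w v * f v ^ 2 := by
    rw [Finset.sum_comm, ← h1]
    exact Finset.sum_congr rfl fun v _ => Finset.sum_congr rfl fun u _ => by rw [hsymm]
  have h3 : ∑ v, ∑ u, w v u * (f v - f u) ^ 2 = ∑ v, ∑ u, w v u * f v ^ 2
      + ∑ v, ∑ u, w v u * f u ^ 2 - 2 * ∑ v, ∑ u, w v u * (f v * f u) := by
    simp only [Finset.mul_sum, ← Finset.sum_add_distrib, ← Finset.sum_sub_distrib]
    exact Finset.sum_congr rfl fun v _ => Finset.sum_congr rfl fun u _ => by ring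
  rw [h3, h1, h2]; ring

section Laplacian

variable {V : Type*} [Fintype V] [DecidableEq V] {w : V → V → ℝ} {h : ℝ}

/-- Conjugating -L by the square roots of the degrees gives a symmetric matrix with the same
characteristic polynomial. Orthogonality to the vector s of these roots becomes weighted mean zero,
so Cheeger's inequality bounds the form; the 1/2 appears because the energy sums over ordered pairs.
-/
theorem half_sq_le_second_eigenvalue (hsymm : ∀ u v, w u v = w v u) (hw : ∀ u v, 0 ≤ w u v)
    (hd : ∀ v, 0 < wdeg w v) (hh : 0 ≤ h) (hexp : Expands w h) (hcard : 2 ≤ Fintype.card V)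
    (L : (V → ℝ) →ₗ[ℝ] (V → ℝ))
    (hL : ∀ f v, L f v = 1 / wdeg w v * ∑ u, w v u * (f u - f v)) :
    h ^ 2 / 2 ≤ ((-L).charpoly.roots.sort (· ≤ ·)).getD 1 0 := by
  set s : V → ℝ := fun v => √(wdeg w v) with hs
  have hspos : ∀ v, 0 < s v := fun v => Real.sqrt_pos.2 (hd v)
  have hsq : ∀ v, s v * s v = wdeg w v := fun v => Real.mul_self_sqrt (hd v).le
  set M := LinearMap.toMatrix (Pi.basisFun ℝ V) (Pi.basisFun ℝ V) (-L) with hM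
  have hMentry : ∀ v u, M v u = (if v = u then 1 else 0) - w v u / wdeg w v := fun v u => by
    have : ∑ x, w v x * ((Pi.single u (1 : ℝ) : V → ℝ) x - (Pi.single u (1 : ℝ) : V → ℝ) v)
        = w v u - wdeg w v * (if v = u then 1 else 0) := by
      simp only [mul_sub, Finset.sum_sub_distrib, ← Finset.sum_mul, Pi.single_apply]
      simp [wdeg]
    rw [hM, LinearMap.toMatrix_apply]
    simp only [Pi.basisFun_apply, Pi.basisFun_repr, LinearMap.neg_apply, Pi.neg_apply]
    rw [hL, this]
    have := (hd v).ne'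
    field_simp
    ring
  set A : Matrix V V ℝ := Matrix.diagonal s * (M * Matrix.diagonal fun v => (s v)⁻¹) with hA
  have hAentry : ∀ v u, A v u = (if v = u then 1 else 0) - w v u / (s v * s u) := fun v u => by
    rw [hA, Matrix.diagonal_mul, Matrix.mul_diagonal, hMentry, ← hsq v]
    have h1 := (hspos v).ne'
    have h2 := (hspos u).ne'
    by_cases hvu : v = u
    · subst hvu; simp only [if_true]; field_simp
    · simp only [hvu, if_false, zero_sub]; field_simp
  have hcp : (-L).charpoly = A.charpoly := by
    rw [← LinearMap.charpoly_toMatrix (-L) (Pi.basisFun ℝ V), hA, Matrix.charpoly_mul_comm,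
      Matrix.mul_assoc, Matrix.diagonal_mul_diagonal]
    have : (fun v => (s v)⁻¹ * s v) = fun _ => 1 := funext fun v => inv_mul_cancel₀ (hspos v).ne'
    rw [this, Matrix.diagonal_one, Matrix.mul_one]
  have hherm : A.IsHermitian := by
    ext v u
    simp only [Matrix.conjTranspose_apply, star_trivial, hAentry, hsymm u v, mul_comm (s u),
      eq_comm (a := u)]
  rw [hcp]
  refine le_sort_roots_getD_one hherm hcard s _ fun y hy => ?_
  set f : V → ℝ := fun v => y v / s v with hf
  have hyf : ∀ v, y v = s v * f v := fun v => by
    rw [hf]; field_simp [(hspos v).ne']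
  have hmean : ∑ v, wdeg w v * f v = 0 := by
    rw [← hy, dotProduct]
    exact Finset.sum_congr rfl fun v _ => by rw [hyf v, ← hsq v]; ring
  have hch := cheeger hsymm hw hh hexp f hmean
  have hyy : y ⬝ᵥ y = ∑ v, wdeg w v * f v ^ 2 :=
    Finset.sum_congr rfl fun v _ => by rw [hyf v, ← hsq v]; ring
  have hyA : y ⬝ᵥ A.mulVec y
      = ∑ v, wdeg w v * f v ^ 2 - ∑ v, ∑ u, w v u * (f v * f u) := by
    rw [← hyy]
    simp only [dotProduct, Matrix.mulVec, ← Finset.sum_sub_distrib]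
    refine Finset.sum_congr rfl fun v _ => ?_
    simp only [hAentry, sub_mul, Finset.sum_sub_distrib, ite_mul, one_mul, zero_mul,
      Finset.sum_ite_eq, Finset.mem_univ, if_true, mul_sub, Finset.mul_sum]
    congr 1
    refine Finset.sum_congr rfl fun u _ => ?_
    have h1 := (hspos v).ne'
    have h2 := (hspos u).ne'
    rw [hf]; field_simp
  rw [hyy, hyA, sum_wdeg_sub_eq_energy hsymm]
  linarith

/-- A connected component and its complement both have zero cut and positive volume, and one of them
has at most half the total. -/
theorem connected_of_expands [Nonempty V] (hd : ∀ v, 0 < wdeg w v) (hh : 0 < h)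
    (hexp : Expands w h) (G : SimpleGraph V) (hG : ∀ u v, u ≠ v → w u v ≠ 0 → G.Adj u v) :
    G.Connected := by
  rw [SimpleGraph.connected_iff_exists_forall_reachable]
  obtain ⟨x⟩ := ‹Nonempty V›
  refine ⟨x, ?_⟩
  by_contra! hx
  obtain ⟨y, hy⟩ := hx
  classical
  set S := Finset.univ.filter fun v => G.Reachable x v with hS
  have hzero : ∀ v u, G.Reachable x v → ¬ G.Reachable x u → w v u = 0 ∧ w u v = 0 := by
    intro v u hv hu
    have hne : v ≠ u := fun hvu => hu (hvu ▸ hv)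
    constructor <;> by_contra h0
    · exact hu (hv.trans (hG v u hne h0).reachable)
    · exact hu (hv.trans (hG u v hne.symm h0).symm.reachable)
  have hcut : wcut w S = 0 := Finset.sum_eq_zero fun v hv => Finset.sum_eq_zero fun u hu =>
    (hzero v u (by simpa [hS] using hv) (by simpa [hS] using hu)).1
  have hcut' : wcut w Sᶜ = 0 := Finset.sum_eq_zero fun v hv => Finset.sum_eq_zero fun u hu =>
    (hzero u v (by simpa [hS] using hu) (by simpa [hS] using hv)).2
  have hpos : 0 < ∑ v ∈ S, wdeg w v := Finset.sum_pos (fun v _ => hd v) ⟨x, by simp [hS]⟩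
  have hpos' : 0 < ∑ v ∈ Sᶜ, wdeg w v := Finset.sum_pos (fun v _ => hd v) ⟨y, by simp [hS, hy]⟩
  have hadd := Finset.sum_add_sum_compl S (wdeg w)
  rcases le_total (∑ v ∈ S, wdeg w v) (∑ v ∈ Sᶜ, wdeg w v) with hle | hle
  · have := hexp S (by linarith)
    nlinarith
  · have := hexp Sᶜ (by linarith)
    nlinarith

end Laplacian

/-! ### The gluing involution -/

section Partner

variable {χ n : ℕ} (P : GoodPartition χ n)

theorem exists_pair_mem_parts (h : HalfEdge χ n) : ∃ h', h' ≠ h ∧ {h, h'} ∈ P.1.parts := by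
  have hmem : P.1.part h ∈ P.1.parts := P.1.part_mem.2 (Finset.mem_univ h)
  have hself : h ∈ P.1.part h := P.1.mem_part (Finset.mem_univ h)
  obtain ⟨x, y, hxy, hpart⟩ := Finset.card_eq_two.1 (P.2 _ hmem).1
  rw [hpart] at hmem hself
  rcases Finset.mem_insert.1 hself with rfl | hy
  · exact ⟨y, hxy.symm, hmem⟩
  · rw [Finset.mem_singleton] at hy
    subst hy
    exact ⟨x, hxy, by rwa [Finset.pair_comm]⟩

/-- The half-edge to which `h` is glued. -/
noncomputable def partner (h : HalfEdge χ n) : HalfEdge χ n :=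
  (exists_pair_mem_parts P h).choose

theorem partner_ne (h : HalfEdge χ n) : partner P h ≠ h := (exists_pair_mem_parts P h).choose_spec.1

theorem pair_partner_mem (h : HalfEdge χ n) : {h, partner P h} ∈ P.1.parts :=
  (exists_pair_mem_parts P h).choose_spec.2

theorem pair_mem_parts_iff {h h' : HalfEdge χ n} : {h, h'} ∈ P.1.parts ↔ partner P h = h' := by
  refine ⟨fun hmem => ?_, fun heq => heq ▸ pair_partner_mem P h⟩
  have h1 := P.1.part_eq_of_mem hmem (Finset.mem_insert_self h _)
  have h2 := P.1.part_eq_of_mem (pair_partner_mem P h) (Finset.mem_insert_self h _)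
  have h3 : partner P h ∈ ({h, h'} : Finset _) := by
    rw [← h1, h2]; simp
  simpa [partner_ne] using h3

@[simp]
theorem partner_partner (h : HalfEdge χ n) : partner P (partner P h) = h := by
  rw [← pair_mem_parts_iff, Finset.pair_comm]
  exact pair_partner_mem P h

theorem partner_injective : Function.Injective (partner P) :=
  (show Function.Involutive (partner P) from partner_partner P).injective

theorem exists_partner_inr (j : Fin n) : ∃ x, partner P (Sum.inr j) = Sum.inl x := by
  obtain ⟨h, hh, hl⟩ := (P.2 _ (pair_partner_mem P (Sum.inr j))).2
  rcases Finset.mem_insert.1 hh with rfl | hh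
  · simp at hl
  · rw [Finset.mem_singleton] at hh
    exact Sum.isLeft_iff.1 (hh ▸ hl)

theorem edgeCount_eq (v u : Vertex χ n) : edgeCount P v u
    = (Finset.univ.filter fun h : HalfEdge χ n => h.vertex = v ∧ (partner P h).vertex = u).card := by
  refine Finset.card_bij' (fun p _ => p.1) (fun h _ => (h, partner P h)) ?_ ?_ ?_ ?_
  · rintro ⟨p, q⟩ hp
    simp only [Finset.mem_filter, Finset.mem_univ, true_and, pair_mem_parts_iff] at hp ⊢
    exact ⟨hp.1, hp.2.2 ▸ hp.2.1⟩
  · intro h hh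
    simp only [Finset.mem_filter, Finset.mem_univ, true_and, pair_mem_parts_iff] at hh ⊢
    exact ⟨hh.1, hh.2, trivial⟩
  · rintro ⟨p, q⟩ hp
    simp only [Finset.mem_filter, Finset.mem_univ, true_and, pair_mem_parts_iff] at hp ⊢
    rw [hp.2.2]
  · intro h _
    rfl

theorem edgeCount_comm (v u : Vertex χ n) : edgeCount P v u = edgeCount P u v := by
  rw [edgeCount_eq, edgeCount_eq]
  refine Finset.card_bij' (fun h _ => partner P h) (fun h _ => partner P h) ?_ ?_ ?_ ?_ <;>
    simp +contextual

theorem sum_sum_edgeCount (S T : Finset (Vertex χ n)) : ∑ v ∈ S, ∑ u ∈ T, edgeCount P v u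
    = (Finset.univ.filter fun h : HalfEdge χ n =>
        h.vertex ∈ S ∧ (partner P h).vertex ∈ T).card := by
  simp only [edgeCount_eq, Finset.card_filter]
  rw [← Finset.sum_product', Finset.sum_comm]
  refine Finset.sum_congr rfl fun h _ => ?_
  simp only [Finset.sum_product, ite_and]
  simp

theorem sum_degree (S : Finset (Vertex χ n)) : ∑ v ∈ S, degree v
    = (Finset.univ.filter fun h : HalfEdge χ n => h.vertex ∈ S).card := by
  simp only [degree, Finset.card_filter]
  rw [Finset.sum_comm]
  simp

theorem sum_edgeCount (v : Vertex χ n) : ∑ u, edgeCount P v u = degree v := by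
  simpa [degree] using sum_sum_edgeCount P {v} Finset.univ

theorem degree_pos (v : Vertex χ n) : 0 < degree v := by
  refine Finset.card_pos.2 ?_
  rcases v with i | j
  · exact ⟨Sum.inl (i, 0), Finset.mem_filter.2 ⟨Finset.mem_univ _, rfl⟩⟩
  · exact ⟨Sum.inr j, Finset.mem_filter.2 ⟨Finset.mem_univ _, rfl⟩⟩

/-- The multiplicities of the edges of `G(P)` as real weights. -/
def weight (v u : Vertex χ n) : ℝ := edgeCount P v u

theorem wdeg_weight (v : Vertex χ n) : wdeg (weight P) v = degree v := by
  simp only [wdeg, weight]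
  exact_mod_cast sum_edgeCount P v

theorem isConnected_and_le_lambdaOne (hcard : 2 ≤ χ + n) {h : ℝ} (hh : 0 < h)
    (hexp : Expands (weight P) h) : IsConnected P ∧ h ^ 2 / 2 ≤ lambdaOne P := by
  have hsymm : ∀ u v, weight P u v = weight P v u := fun u v => by
    simp only [weight, edgeCount_comm P u v]
  have hd : ∀ v, 0 < wdeg (weight P) v := fun v => by
    rw [wdeg_weight]; exact_mod_cast degree_pos v
  have hcard' : 2 ≤ Fintype.card (Vertex χ n) := by simpa [Vertex] using hcard
  have : Nonempty (Vertex χ n) := Fintype.card_pos_iff.1 (by omega)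
  refine ⟨connected_of_expands hd hh hexp _ fun u v huv hne => ?_,
    half_sq_le_second_eigenvalue hsymm (fun u v => Nat.cast_nonneg _) hd hh.le hexp hcard' _
      fun f v => ?_⟩
  · rw [underlyingGraph, SimpleGraph.fromRel_adj]
    exact ⟨huv, Or.inl (Nat.pos_of_ne_zero fun h0 => hne (by simp [weight, h0]))⟩
  · rw [wdeg_weight]; rfl

end Partner

/-! ### Reduction to sets of interior vertices -/

section Isoperimetry

variable {χ n : ℕ} (P : GoodPartition χ n)

open Classical in
/-- The half-edges in `H` which are glued to a boundary half-edge. -/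
noncomputable def leafSet (H : Finset (Fin χ × Fin 3)) : Finset (Fin χ × Fin 3) :=
  H.filter fun x => ∃ j, partner P (Sum.inl x) = Sum.inr j

open Classical in
/-- The half-edges in `H` which are glued to an interior half-edge outside `H`. -/
noncomputable def cutSet (H : Finset (Fin χ × Fin 3)) : Finset (Fin χ × Fin 3) :=
  H.filter fun x => ∃ y, partner P (Sum.inl x) = Sum.inl y ∧ y ∉ H

/-- The half-edges emanating from a set of interior vertices. -/
def halfEdges (A : Finset (Fin χ)) : Finset (Fin χ × Fin 3) := A ×ˢ Finset.univ

theorem card_halfEdges (A : Finset (Fin χ)) : (halfEdges A).card = 3 * A.card := by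
  simp [halfEdges, Finset.card_product, mul_comm]

theorem card_vertex_mem (S : Finset (Vertex χ n)) :
    (Finset.univ.filter fun h : HalfEdge χ n => h.vertex ∈ S).card
      = 3 * S.toLeft.card + S.toRight.card := by
  have : (Finset.univ.filter fun h : HalfEdge χ n => h.vertex ∈ S)
      = (halfEdges S.toLeft).disjSum S.toRight := by
    ext (⟨i, k⟩ | j) <;> rw [Finset.mem_filter] <;> simp [HalfEdge.vertex, halfEdges]
  rw [this, Finset.card_disjSum, card_halfEdges]

/-- A boundary vertex of S whose neighbour lies outside S adds one to the volume and one to the cut,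
which is harmless. The others are attached to the interior part A of S, so `leafSet` accounts for
them. Removing the boundary vertices only decreases the volume, whence 6|A| ≤ 3χ + n. -/
theorem expands_of_forall_cutSet
    (hcut : ∀ A : Finset (Fin χ), A.Nonempty → 6 * A.card ≤ 3 * χ + n →
      3 * A.card + (leafSet P (halfEdges A)).card ≤ 150 * (cutSet P (halfEdges A)).card) :
    Expands (weight P) (1 / 150) := by
  classical
  intro S hS
  set A := S.toLeft with hA
  have hvol : ∀ T : Finset (Vertex χ n), ∑ v ∈ T, wdeg (weight P) v
      = ((3 * T.toLeft.card + T.toRight.card : ℕ) : ℝ) := fun T => by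
    rw [← card_vertex_mem, ← sum_degree, Nat.cast_sum]
    exact Finset.sum_congr rfl fun v _ => wdeg_weight P v
  have hwcut : wcut (weight P) S = ((Finset.univ.filter fun h : HalfEdge χ n =>
      h.vertex ∈ S ∧ (partner P h).vertex ∈ Sᶜ).card : ℝ) := by
    rw [← sum_sum_edgeCount]; push_cast; rfl
  have hall : (Finset.univ : Finset (Vertex χ n)).toLeft.card = χ
      ∧ (Finset.univ : Finset (Vertex χ n)).toRight.card = n := by simp
  rw [hvol S, hvol Finset.univ, hall.1, hall.2] at hS
  rw [hvol S, hwcut]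
  set X := S.toRight.filter fun j => (partner P (Sum.inr j)).vertex ∈ Sᶜ with hX
  set Y := S.toRight.filter fun j => ¬ (partner P (Sum.inr j)).vertex ∈ Sᶜ with hY
  have hXY : X.card + Y.card = S.toRight.card := Finset.card_filter_add_card_filter_not _
  have hYle : Y.card ≤ (leafSet P (halfEdges A)).card := by
    have hsub : Y.image (fun j => partner P (Sum.inr j))
        ⊆ (leafSet P (halfEdges A)).image (Sum.inl : _ → HalfEdge χ n) := by
      intro h hh
      obtain ⟨j, hj, rfl⟩ := Finset.mem_image.1 hh
      obtain ⟨x, hx⟩ := exists_partner_inr P j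
      refine Finset.mem_image.2 ⟨x, ?_, hx.symm⟩
      have hxS : (partner P (Sum.inr j)).vertex ∈ S := by
        simpa using (Finset.mem_filter.1 hj).2
      rw [hx] at hxS
      simp only [leafSet, Finset.mem_filter]
      refine ⟨by simpa [halfEdges, hA, HalfEdge.vertex] using hxS, j, ?_⟩
      rw [← hx, partner_partner]
    have := Finset.card_le_card hsub
    rwa [Finset.card_image_of_injective Y (f := fun j => partner P (Sum.inr j)) ((partner_injective P).comp Sum.inr_injective),
      Finset.card_image_of_injective _ Sum.inl_injective] at this
  have hcutle : (cutSet P (halfEdges A)).card + X.card ≤ (Finset.univ.filter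
      fun h : HalfEdge χ n => h.vertex ∈ S ∧ (partner P h).vertex ∈ Sᶜ).card := by
    rw [← Finset.card_disjSum]
    refine Finset.card_le_card fun h hh => ?_
    rcases h with x | j
    · rw [Finset.inl_mem_disjSum] at hh
      obtain ⟨hxH, y, hy, hyH⟩ := Finset.mem_filter.1 hh
      simp only [Finset.mem_filter, Finset.mem_univ, true_and, hy]
      simpa [halfEdges, hA, HalfEdge.vertex] using And.intro hxH hyH
    · rw [Finset.inr_mem_disjSum] at hh
      simpa [hX, HalfEdge.vertex] using hh
  have hmain : 3 * A.card + S.toRight.card ≤ 150 * (Finset.univ.filter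
      fun h : HalfEdge χ n => h.vertex ∈ S ∧ (partner P h).vertex ∈ Sᶜ).card := by
    rcases A.eq_empty_or_nonempty with h0 | hne
    · have : (leafSet P (halfEdges A)).card = 0 := by simp [h0, halfEdges, leafSet]
      rw [h0, Finset.card_empty]
      omega
    · have h6 : 2 * (3 * A.card + S.toRight.card) ≤ 3 * χ + n := by exact_mod_cast hS
      have := hcut A hne (by omega)
      omega
  have : ((3 * A.card + S.toRight.card : ℕ) : ℝ) ≤ 150 * ((Finset.univ.filter
      fun h : HalfEdge χ n => h.vertex ∈ S ∧ (partner P h).vertex ∈ Sᶜ).card : ℝ) := by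
    exact_mod_cast hmain
  linarith

end Isoperimetry

/-! ### Counting half-edge sets for a fixed partition -/

section Counting

variable {χ n : ℕ} (P : GoodPartition χ n)

/-- The pairs of `P` which are contained in a set `H` of interior half-edges. -/
def innerPairs (H : Finset (Fin χ × Fin 3)) : Finset (Finset (HalfEdge χ n)) :=
  P.1.parts.filter fun p => p ⊆ H.map Function.Embedding.inl

theorem mem_leafSet {H : Finset (Fin χ × Fin 3)} {x : Fin χ × Fin 3} :
    x ∈ leafSet P H ↔ x ∈ H ∧ ∃ j, partner P (Sum.inl x) = Sum.inr j := by
  simp [leafSet]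

theorem mem_cutSet {H : Finset (Fin χ × Fin 3)} {x : Fin χ × Fin 3} :
    x ∈ cutSet P H ↔ x ∈ H ∧ ∃ y, partner P (Sum.inl x) = Sum.inl y ∧ y ∉ H := by
  simp [cutSet]

theorem exists_mem_innerPairs_iff {H : Finset (Fin χ × Fin 3)} {h : HalfEdge χ n} :
    (∃ p ∈ innerPairs P H, h ∈ p)
      ↔ ∃ x ∈ H, h = Sum.inl x ∧ ∃ y ∈ H, partner P (Sum.inl x) = Sum.inl y := by
  constructor
  · rintro ⟨p, hp, hxp⟩
    obtain ⟨hpP, hpH⟩ := Finset.mem_filter.1 hp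
    have hpe : p = {h, partner P h} := by
      rw [← P.1.part_eq_of_mem hpP hxp]
      exact P.1.part_eq_of_mem (pair_partner_mem P h) (Finset.mem_insert_self _ _)
    obtain ⟨x, hx, hxh⟩ := Finset.mem_map.1 (hpH hxp)
    obtain ⟨y, hy, hyh⟩ := Finset.mem_map.1 (hpH (hpe ▸ by simp : partner P h ∈ p))
    exact ⟨x, hx, hxh.symm, y, hy, by rw [show (Sum.inl x : HalfEdge χ n) = h from hxh, ← hyh]; rfl⟩
  · rintro ⟨x, hx, rfl, y, hy, hxy⟩
    refine ⟨_, Finset.mem_filter.2 ⟨pair_partner_mem P (Sum.inl x), ?_⟩, Finset.mem_insert_self _ _⟩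
    rw [hxy]
    intro z hz
    rcases Finset.mem_insert.1 hz with rfl | hz
    · simpa using hx
    · rw [Finset.mem_singleton.1 hz]; simpa using hy

theorem mem_iff_leafSet_cutSet_innerPairs {H : Finset (Fin χ × Fin 3)} {x : Fin χ × Fin 3} :
    x ∈ H ↔ x ∈ leafSet P H ∨ x ∈ cutSet P H ∨ ∃ p ∈ innerPairs P H, Sum.inl x ∈ p := by
  rw [exists_mem_innerPairs_iff, mem_leafSet, mem_cutSet]
  constructor
  · intro hx
    rcases hp : partner P (Sum.inl x) with y | j
    · by_cases hy : y ∈ H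
      · exact Or.inr (Or.inr ⟨x, hx, rfl, y, hy, hp⟩)
      · exact Or.inr (Or.inl ⟨hx, y, rfl, hy⟩)
    · exact Or.inl ⟨hx, j, rfl⟩
  · rintro (h | h | ⟨y, hy, hxy, -⟩)
    · exact h.1
    · exact h.1
    · rwa [Sum.inl_injective hxy]

theorem card_eq_leafSet_add_cutSet_add_innerPairs (H : Finset (Fin χ × Fin 3)) :
    2 * (innerPairs P H).card + (leafSet P H).card + (cutSet P H).card = H.card := by
  classical
  have hcard : ((innerPairs P H).biUnion id).card = 2 * (innerPairs P H).card := by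
    rw [Finset.card_biUnion]
    · have h2 : ∀ p ∈ innerPairs P H, (id p).card = 2 :=
        fun p hp => (P.2 p (Finset.mem_filter.1 hp).1).1
      rw [Finset.sum_congr rfl h2]
      simp [mul_comm]
    · intro p hp q hq hpq
      exact P.1.disjoint (Finset.mem_filter.1 hp).1 (Finset.mem_filter.1 hq).1 hpq
  have hmap : H.map Function.Embedding.inl = ((innerPairs P H).biUnion id)
      ∪ ((leafSet P H).map Function.Embedding.inl ∪ (cutSet P H).map Function.Embedding.inl) := by
    ext h
    simp only [Finset.mem_union, Finset.mem_biUnion, id]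
    rcases h with x | j
    · have := mem_iff_leafSet_cutSet_innerPairs P (H := H) (x := x)
      simp only [Finset.mem_map, Function.Embedding.inl_apply, Sum.inl.injEq, exists_eq_right]
      rw [this, ← or_assoc, or_comm]
    · rw [exists_mem_innerPairs_iff]; simp
  have hdisj : Disjoint (leafSet P H) (cutSet P H) := by
    rw [Finset.disjoint_left]
    intro x hx hx'
    obtain ⟨-, j, hj⟩ := (mem_leafSet P).1 hx
    obtain ⟨-, y, hy, -⟩ := (mem_cutSet P).1 hx'
    simp [hj] at hy
  have hdisj' : Disjoint ((innerPairs P H).biUnion id)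
      ((leafSet P H).map Function.Embedding.inl ∪ (cutSet P H).map Function.Embedding.inl) := by
    rw [Finset.disjoint_left]
    intro h hh
    obtain ⟨x, hx, rfl, y, hy, hxy⟩ :=
      (exists_mem_innerPairs_iff P).1 (by simpa using hh : ∃ p ∈ innerPairs P H, h ∈ p)
    simp only [Finset.mem_union, Finset.mem_map, Function.Embedding.inl_apply, Sum.inl.injEq,
      exists_eq_right, mem_leafSet, mem_cutSet, hxy]
    rintro (⟨-, j, hj⟩ | ⟨-, z, hz, hzH⟩)
    · simp at hj
    · exact hzH (hz ▸ hy)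
  have htotal := congrArg Finset.card hmap
  rw [Finset.card_map, Finset.card_union_of_disjoint hdisj', Finset.card_union_of_disjoint
    ((Finset.disjoint_map _).2 hdisj), Finset.card_map, Finset.card_map, hcard] at htotal
  omega

theorem card_leafSet_univ : (leafSet P Finset.univ).card = n := by
  classical
  have : (leafSet P Finset.univ).image (fun x => partner P (Sum.inl x))
      = Finset.univ.image Sum.inr := by
    ext h
    simp only [Finset.mem_image, mem_leafSet, Finset.mem_univ, true_and]
    constructor
    · rintro ⟨x, ⟨j, hj⟩, rfl⟩
      exact ⟨j, hj.symm⟩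
    · rintro ⟨j, rfl⟩
      obtain ⟨x, hx⟩ := exists_partner_inr P j
      have : partner P (Sum.inl x) = Sum.inr j := by rw [← hx, partner_partner]
      exact ⟨x, ⟨j, this⟩, this⟩
  have hcard := congrArg Finset.card this
  rwa [Finset.card_image_of_injective _ Sum.inr_injective, Finset.card_univ, Fintype.card_fin,
    Finset.card_image_of_injective _ (f := fun x => partner P (Sum.inl x))
      ((partner_injective P).comp Sum.inl_injective)] at hcard

theorem two_mul_card_innerPairs_univ : 2 * (innerPairs P Finset.univ).card + n = 3 * χ := by
  have h := card_eq_leafSet_add_cutSet_add_innerPairs P Finset.univ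
  have hc : cutSet P Finset.univ = ∅ := by
    ext x; simp [mem_cutSet]
  rw [card_leafSet_univ, hc] at h
  simp only [Finset.card_empty, Finset.card_univ, Fintype.card_prod, Fintype.card_fin] at h
  omega

/-- H is recovered from its leaf-glued half-edges, its inner pairs and its cut half-edges. These are
subsets of the n leaf-glued half-edges, of the m interior pairs and of all 3χ interior half-edges,
of sizes b, t and e. -/
theorem card_subsets_le {m k b e t : ℕ} (hm : 2 * m + n = 3 * χ) (ht : 2 * t + b + e = k) :
    ((Finset.univ.powersetCard k).filter fun H : Finset (Fin χ × Fin 3) =>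
        (leafSet P H).card = b ∧ (cutSet P H).card = e).card
      ≤ n.choose b * m.choose t * (3 * χ).choose e := by
  classical
  have hmcard : (innerPairs P Finset.univ).card = m := by
    have := two_mul_card_innerPairs_univ P; omega
  have hI : (Finset.univ : Finset (Fin χ × Fin 3)).card = 3 * χ := by
    simp [mul_comm]
  refine le_trans ?_ (le_of_eq (by rw [card_leafSet_univ, hmcard, hI] :
    (leafSet P Finset.univ).card.choose b * (innerPairs P Finset.univ).card.choose t
      * (Finset.univ : Finset (Fin χ × Fin 3)).card.choose e = _))
  rw [← Finset.card_powersetCard, ← Finset.card_powersetCard, ← Finset.card_powersetCard,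
    ← Finset.card_product, ← Finset.card_product]
  refine Finset.card_le_card_of_injOn (fun H => ((leafSet P H, innerPairs P H), cutSet P H)) ?_ ?_
  · intro H hH
    obtain ⟨hH, hb, he⟩ := Finset.mem_filter.1 hH
    have hk := (Finset.mem_powersetCard.1 hH).2
    have hid := card_eq_leafSet_add_cutSet_add_innerPairs P H
    simp only [Finset.coe_product, Set.mem_prod, Finset.mem_coe, Finset.mem_powersetCard]
    refine ⟨⟨⟨fun x hx => ?_, hb⟩, fun p hp => ?_, by omega⟩, Finset.subset_univ _, he⟩
    · exact (mem_leafSet P).2 ⟨Finset.mem_univ x, ((mem_leafSet P).1 hx).2⟩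
    · obtain ⟨h1, h2⟩ := Finset.mem_filter.1 hp
      exact Finset.mem_filter.2 ⟨h1, h2.trans (Finset.map_subset_map.2 (Finset.subset_univ H))⟩
  · intro H _ H' _ heq
    simp only [Prod.mk.injEq] at heq
    ext x
    rw [mem_iff_leafSet_cutSet_innerPairs P, heq.1.1, heq.1.2, heq.2,
      ← mem_iff_leafSet_cutSet_innerPairs P]

end Counting

/-! ### Invariance under permutations of the interior half-edges -/

section Symmetry

variable {χ n : ℕ}

/-- A permutation of the interior half-edges as a permutation of all half-edges. -/
def extendPerm (n : ℕ) (π : Equiv.Perm (Fin χ × Fin 3)) : Equiv.Perm (HalfEdge χ n) :=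
  Equiv.sumCongr π (Equiv.refl _)

/-- The action of the permutations of the interior half-edges on the good partitions. -/
def relabel (π : Equiv.Perm (Fin χ × Fin 3)) (P : GoodPartition χ n) : GoodPartition χ n :=
  ⟨Finpartition.ofExistsUnique (P.1.parts.image (Finset.map (extendPerm n π).toEmbedding))
    (fun _ _ => Finset.subset_univ _)
    (fun h _ => by
      refine ⟨(P.1.part ((extendPerm n π).symm h)).map (extendPerm n π).toEmbedding,
        ⟨Finset.mem_image_of_mem _ (P.1.part_mem.2 (Finset.mem_univ _)), ?_⟩, ?_⟩
      · exact Finset.mem_map.2 ⟨_, P.1.mem_part (Finset.mem_univ _), by simp⟩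
      · rintro q ⟨hq, hhq⟩
        obtain ⟨p, hp, rfl⟩ := Finset.mem_image.1 hq
        rw [Finset.mem_map_equiv] at hhq
        rw [P.1.part_eq_of_mem hp hhq])
    (fun hbot => by
      obtain ⟨p, hp, hpe⟩ := Finset.mem_image.1 hbot
      exact P.1.ne_bot hp (by simpa using hpe)), by
    intro q hq
    obtain ⟨p, hp, rfl⟩ := Finset.mem_image.1 hq
    obtain ⟨h2, h, hh, hl⟩ := P.2 p hp
    refine ⟨by rwa [Finset.card_map], extendPerm n π h, Finset.mem_map_of_mem _ hh, ?_⟩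
    rcases h with x | j
    · rfl
    · simp at hl⟩

theorem parts_relabel (π : Equiv.Perm (Fin χ × Fin 3)) (P : GoodPartition χ n) :
    (relabel π P).1.parts = P.1.parts.image (Finset.map (extendPerm n π).toEmbedding) := rfl

theorem relabel_injective (π : Equiv.Perm (Fin χ × Fin 3)) :
    Function.Injective (relabel (n := n) π) := fun P Q hPQ => by
  have h : (relabel π P).1.parts = (relabel π Q).1.parts := by rw [hPQ]
  rw [parts_relabel, parts_relabel] at h
  exact Subtype.ext (Finpartition.ext (Finset.image_injective (Finset.map_injective _) h))

theorem partner_relabel (π : Equiv.Perm (Fin χ × Fin 3)) (P : GoodPartition χ n)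
    (h : HalfEdge χ n) :
    partner (relabel π P) (extendPerm n π h) = extendPerm n π (partner P h) := by
  rw [← pair_mem_parts_iff, parts_relabel]
  refine Finset.mem_image.2 ⟨_, pair_partner_mem P h, ?_⟩
  simp [Finset.map_insert]

theorem leafSet_relabel (π : Equiv.Perm (Fin χ × Fin 3)) (P : GoodPartition χ n)
    (H : Finset (Fin χ × Fin 3)) :
    leafSet (relabel π P) (H.map π.toEmbedding) = (leafSet P H).map π.toEmbedding := by
  ext x
  obtain ⟨x, rfl⟩ := π.surjective x
  have h := partner_relabel π P (Sum.inl x)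
  rw [show extendPerm n π (Sum.inl x) = Sum.inl (π x) from rfl] at h
  rw [mem_leafSet, h, Finset.mem_map_equiv, Finset.mem_map_equiv, mem_leafSet,
    Equiv.symm_apply_apply]
  rcases hp : partner P (Sum.inl x) with y | j <;> simp [extendPerm]

theorem cutSet_relabel (π : Equiv.Perm (Fin χ × Fin 3)) (P : GoodPartition χ n)
    (H : Finset (Fin χ × Fin 3)) :
    cutSet (relabel π P) (H.map π.toEmbedding) = (cutSet P H).map π.toEmbedding := by
  ext x
  obtain ⟨x, rfl⟩ := π.surjective x
  have h := partner_relabel π P (Sum.inl x)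
  rw [show extendPerm n π (Sum.inl x) = Sum.inl (π x) from rfl] at h
  rw [mem_cutSet, h, Finset.mem_map_equiv, Finset.mem_map_equiv, mem_cutSet,
    Equiv.symm_apply_apply]
  rcases hp : partner P (Sum.inl x) with y | j <;> simp [extendPerm]

theorem exists_perm_map_eq {α : Type*} [Fintype α] [DecidableEq α] {H H' : Finset α}
    (hcard : H.card = H'.card) : ∃ π : Equiv.Perm α, H.map π.toEmbedding = H' := by
  let ε : {x // x ∈ H} ≃ {x // x ∈ H'} := Finset.equivOfCardEq hcard
  refine ⟨ε.extendSubtype, Finset.eq_of_subset_of_card_le (fun y hy => ?_) ?_⟩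
  · obtain ⟨x, hx, rfl⟩ := Finset.mem_map.1 hy
    exact ε.extendSubtype_mem x hx
  · rw [Finset.card_map, hcard]

end Symmetry

/-! ### First moment bound -/

section Probability

variable {χ n : ℕ}

noncomputable instance : Fintype (GoodPartition χ n) := Fintype.ofFinite _

theorem prob_eq (Q : GoodPartition χ n → Prop) [DecidablePred Q] : Prob χ n Q
    = ((Finset.univ.filter Q).card : ℝ) / Fintype.card (GoodPartition χ n) := by
  rw [Prob, Nat.card_eq_fintype_card, Nat.card_eq_fintype_card, Fintype.card_subtype]

theorem prob_le_one (Q : GoodPartition χ n → Prop) : Prob χ n Q ≤ 1 := by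
  classical
  rw [prob_eq]
  exact div_le_one_of_le₀ (by exact_mod_cast Finset.card_le_univ _) (by positivity)

theorem prob_le_sum {ι : Type*} (s : Finset ι) (Q : GoodPartition χ n → Prop)
    (R : ι → GoodPartition χ n → Prop) (hQ : ∀ P, Q P → ∃ i ∈ s, R i P) :
    Prob χ n Q ≤ ∑ i ∈ s, Prob χ n (R i) := by
  classical
  simp only [prob_eq, ← Finset.sum_div]
  gcongr
  have : Finset.univ.filter Q ⊆ s.biUnion fun i => Finset.univ.filter (R i) := fun P hP => by
    obtain ⟨i, hi, hR⟩ := hQ P (by simpa using hP)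
    simpa using ⟨i, hi, hR⟩
  exact_mod_cast (Finset.card_le_card this).trans Finset.card_biUnion_le

theorem one_sub_prob_le [Nonempty (GoodPartition χ n)] (Q R : GoodPartition χ n → Prop)
    (h : ∀ P, ¬ R P → Q P) : 1 - Prob χ n R ≤ Prob χ n Q := by
  classical
  have hpos : (0 : ℝ) < Fintype.card (GoodPartition χ n) := by exact_mod_cast Fintype.card_pos
  rw [prob_eq, prob_eq, sub_le_iff_le_add, ← add_div, le_div_iff₀ hpos, one_mul]
  have : (Finset.univ : Finset (GoodPartition χ n))
      ⊆ Finset.univ.filter Q ∪ Finset.univ.filter R := fun P _ => by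
    by_cases hR : R P
    · simp [hR]
    · simp [h P hR]
  exact_mod_cast (Finset.card_le_card this).trans (Finset.card_union_le _ _)

/-- Double counting of pairs (H', P): by symmetry every H' of size k occurs with at least as many P
as H does, while each P admits at most the number of H' given by `card_subsets_le`. -/
theorem choose_mul_card_le {m k b e t : ℕ} (hm : 2 * m + n = 3 * χ) (ht : 2 * t + b + e = k)
    (H : Finset (Fin χ × Fin 3)) (hH : H.card = k) :
    (3 * χ).choose k * (Finset.univ.filter fun P : GoodPartition χ n =>
        (leafSet P H).card = b ∧ (cutSet P H).card = e).card
      ≤ Fintype.card (GoodPartition χ n) * (n.choose b * m.choose t * (3 * χ).choose e) := by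
  classical
  have hI : (Finset.univ : Finset (Fin χ × Fin 3)).card = 3 * χ := by simp [mul_comm]
  have h1 : ∀ H' ∈ Finset.univ.powersetCard k, (Finset.univ.filter fun P : GoodPartition χ n =>
        (leafSet P H).card = b ∧ (cutSet P H).card = e).card
      ≤ (Finset.univ.filter fun P : GoodPartition χ n =>
        (leafSet P H').card = b ∧ (cutSet P H').card = e).card := fun H' hH' => by
    obtain ⟨π, hπ⟩ := exists_perm_map_eq (hH.trans (Finset.mem_powersetCard.1 hH').2.symm)
    refine Finset.card_le_card_of_injOn (relabel π) (fun P hP => ?_) (relabel_injective π).injOn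
    simpa [← hπ, leafSet_relabel, cutSet_relabel] using hP
  have h2 := Finset.card_nsmul_le_sum _ _ _ h1
  rw [Finset.card_powersetCard, hI, smul_eq_mul] at h2
  refine h2.trans ?_
  simp only [Finset.card_filter]
  rw [Finset.sum_comm]
  simp only [← Finset.card_filter]
  refine (Finset.sum_le_card_nsmul _ _ _ fun P _ => card_subsets_le P hm ht).trans_eq ?_
  rw [Finset.card_univ, smul_eq_mul]

/-- Some set of `a` interior vertices has `b` half-edges glued to the boundary and `e` half-edges
glued to other interior vertices. -/
def HasCut (a b e : ℕ) (P : GoodPartition χ n) : Prop :=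
  ∃ A : Finset (Fin χ), A.card = a ∧ (leafSet P (halfEdges A)).card = b
    ∧ (cutSet P (halfEdges A)).card = e

theorem prob_hasCut_le {m a b e : ℕ} (hm : 2 * m + n = 3 * χ) (ha : a ≤ χ) {C : ℝ} (hC₀ : 0 ≤ C)
    (hC : ∀ t, 2 * t + b + e = 3 * a →
      (χ.choose a : ℝ) * n.choose b * m.choose t * (3 * χ).choose e / (3 * χ).choose (3 * a) ≤ C) :
    Prob χ n (HasCut a b e) ≤ C := by
  classical
  -- If the event is empty there may be no t with 2t + b + e = 3a, so that `hC` says nothing;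
  -- otherwise a witness supplies t.
  by_cases hex : ∃ P : GoodPartition χ n, HasCut a b e P
  swap
  · have : Finset.univ.filter (HasCut (χ := χ) (n := n) a b e) = ∅ :=
      Finset.filter_false_of_mem fun P _ hP => hex ⟨P, hP⟩
    rw [prob_eq, this]
    simpa using hC₀
  obtain ⟨P₀, A₀, hA₀, hb₀, he₀⟩ := hex
  have ht := card_eq_leafSet_add_cutSet_add_innerPairs P₀ (halfEdges A₀)
  rw [hb₀, he₀, card_halfEdges, hA₀] at ht
  refine le_trans ?_ (hC _ ht)
  set t := (innerPairs P₀ (halfEdges A₀)).card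
  set R : Finset (Fin χ) → GoodPartition χ n → Prop := fun A P =>
    (leafSet P (halfEdges A)).card = b ∧ (cutSet P (halfEdges A)).card = e
  have hpos : (0 : ℝ) < Fintype.card (GoodPartition χ n) := by
    exact_mod_cast Fintype.card_pos_iff.2 ⟨P₀⟩
  have hpos' : (0 : ℝ) < (3 * χ).choose (3 * a) := by
    exact_mod_cast Nat.choose_pos (by omega)
  have hsingle : ∀ A ∈ (Finset.univ : Finset (Fin χ)).powersetCard a, Prob χ n (R A)
      ≤ (n.choose b : ℝ) * m.choose t * (3 * χ).choose e / (3 * χ).choose (3 * a) := by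
    intro A hA
    have h := choose_mul_card_le (n := n) hm ht (halfEdges A) (by
      rw [card_halfEdges, (Finset.mem_powersetCard.1 hA).2])
    have h' : ((3 * χ).choose (3 * a) : ℝ) * ((Finset.univ.filter (R A)).card : ℝ)
        ≤ Fintype.card (GoodPartition χ n)
          * ((n.choose b : ℝ) * m.choose t * (3 * χ).choose e) := by exact_mod_cast h
    rw [prob_eq, div_le_div_iff₀ hpos hpos']
    linarith
  refine (prob_le_sum _ _ R fun P ⟨A, hA, hAR⟩ =>
    ⟨A, Finset.mem_powersetCard.2 ⟨Finset.subset_univ A, hA⟩, hAR⟩).trans ?_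
  refine (Finset.sum_le_card_nsmul _ _ _ hsingle).trans_eq ?_
  rw [Finset.card_powersetCard, Finset.card_univ, Fintype.card_fin, nsmul_eq_mul]
  ring

/-- Needed because `Prob` is 0/0 = 0 on an empty model. Of the interior half-edges, n are matched
with the boundary and the other 2m are paired among themselves. -/
theorem nonempty_goodPartition {m : ℕ} (hm : 2 * m + n = 3 * χ) : Nonempty (GoodPartition χ n) := by
  classical
  let ε : Fin χ × Fin 3 ≃ Fin n ⊕ Fin m × Fin 2 := Fintype.equivOfCardEq (by simp; omega)
  let key : HalfEdge χ n → Fin n ⊕ Fin m := Sum.elim (fun x => Sum.map id Prod.fst (ε x)) Sum.inl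
  let F : Fin n ⊕ Fin m → Finset (HalfEdge χ n) := Sum.elim
    (fun j => {Sum.inl (ε.symm (Sum.inl j)), Sum.inr j})
    (fun i => {Sum.inl (ε.symm (Sum.inr (i, 0))), Sum.inl (ε.symm (Sum.inr (i, 1)))})
  have hF : ∀ c h, h ∈ F c ↔ key h = c := by
    rintro (j | i) (x | k)
    · obtain ⟨(l | ⟨i, z⟩), rfl⟩ := ε.symm.surjective x <;> simp [F, key]
    · simp [F, key]
    · obtain ⟨(l | ⟨i, z⟩), rfl⟩ := ε.symm.surjective x
      · simp [F, key]
      · fin_cases z <;> simp [F, key]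
    · simp [F, key]
  have hne : ∀ c, ∃ x, Sum.inl x ∈ F c := by
    rintro (j | i)
    · exact ⟨ε.symm (Sum.inl j), by simp [F]⟩
    · exact ⟨ε.symm (Sum.inr (i, 0)), by simp [F]⟩
  refine ⟨⟨Finpartition.ofExistsUnique (Finset.univ.image F) (fun _ _ => Finset.subset_univ _)
    (fun h _ => ⟨F (key h), ⟨Finset.mem_image_of_mem _ (Finset.mem_univ _), (hF _ _).2 rfl⟩, ?_⟩)
    fun hbot => ?_, ?_⟩⟩
  · rintro q ⟨hq, hhq⟩
    obtain ⟨c, -, rfl⟩ := Finset.mem_image.1 hq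
    rw [(hF c h).1 hhq]
  · obtain ⟨c, -, hc⟩ := Finset.mem_image.1 hbot
    obtain ⟨x, hx⟩ := hne c
    simp [hc] at hx
  · intro p hp
    obtain ⟨c, -, rfl⟩ := Finset.mem_image.1 hp
    refine ⟨?_, ?_⟩
    · rcases c with j | i
      · exact Finset.card_pair (by simp)
      · exact Finset.card_pair (by simp)
    · obtain ⟨x, hx⟩ := hne c
      exact ⟨_, hx, rfl⟩

end Probability

/-! ### Estimates for binomial coefficients -/

section Binomials

/-- The free parameter x allows one scale, proportional to a, to serve for all the lower indices b,
t and e, including zero. -/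
theorem choose_le_pow_mul_exp (N k : ℕ) {x : ℝ} (hx : 0 < x) :
    (N.choose k : ℝ) ≤ (N / x) ^ k * Real.exp x := by
  calc (N.choose k : ℝ) ≤ (N : ℝ) ^ k / k.factorial := Nat.choose_le_pow_div k N
    _ = (N / x) ^ k * (x ^ k / k.factorial) := by
        rw [div_pow]; field_simp
    _ ≤ (N / x) ^ k * Real.exp x := by
        gcongr
        exact Real.pow_div_factorial_le_exp x hx.le k

theorem choose_mul_pow_mul_pow_le_one {N k : ℕ} (hk : k ≤ N) {p q : ℝ} (hp : 0 ≤ p) (hq : 0 ≤ q)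
    (hpq : p + q = 1) : (N.choose k : ℝ) * p ^ k * q ^ (N - k) ≤ 1 := by
  have h := add_pow p q N
  rw [hpq, one_pow] at h
  rw [h]
  have := Finset.single_le_sum (f := fun j => p ^ j * q ^ (N - j) * (N.choose j : ℝ))
    (fun j _ => by positivity) (Finset.mem_range.2 (Nat.lt_succ_of_le hk))
  refine le_trans (le_of_eq ?_) this
  ring

/-- A binomial distribution with integral mean `k` has its mode at `k`. -/
theorem choose_mul_pow_mul_pow_le_mode (k l : ℕ) {j : ℕ} (hj : j ≤ k + l) :
    (k + l).choose j * k ^ j * l ^ (k + l - j) ≤ (k + l).choose k * k ^ k * l ^ l := by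
  set T : ℕ → ℕ := fun i => (k + l).choose i * k ^ i * l ^ (k + l - i) with hT
  have hstep : ∀ i M, i + 1 + M = k + l →
      T (i + 1) * (i + 1) = (k + l).choose i * k ^ i * l ^ M * (k * (M + 1))
        ∧ T i * (i + 1) = (k + l).choose i * k ^ i * l ^ M * ((i + 1) * l) := by
    intro i M hM
    have h := Nat.choose_succ_right_eq (k + l) i
    rw [show k + l - i = M + 1 by omega] at h
    simp only [hT, show k + l - i = M + 1 by omega, show k + l - (i + 1) = M by omega]
    constructor
    · calc (k + l).choose (i + 1) * k ^ (i + 1) * l ^ M * (i + 1)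
          = ((k + l).choose (i + 1) * (i + 1)) * k ^ (i + 1) * l ^ M := by ring
        _ = _ := by rw [h]; ring
    · ring
  have hTk : (k + l).choose k * k ^ k * l ^ l = T k := by simp [hT]
  rw [hTk]
  change T j ≤ T k
  rcases le_total j k with hjk | hjk
  · induction hjk using Nat.decreasingInduction with
    | self => rfl
    | of_succ i hi ih =>
      obtain ⟨M, hM⟩ := Nat.exists_eq_add_of_le (show i + 1 ≤ k + l by omega)
      obtain ⟨h1, h2⟩ := hstep i M hM.symm
      refine le_trans (Nat.le_of_mul_le_mul_right (c := i + 1) ?_ (by omega)) (ih (by omega))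
      rw [h1, h2]
      exact Nat.mul_le_mul_left _ (Nat.mul_le_mul (by omega) (by omega))
  · induction j, hjk using Nat.le_induction with
    | base => rfl
    | succ i hi ih =>
      obtain ⟨M, hM⟩ := Nat.exists_eq_add_of_le hj
      obtain ⟨h1, h2⟩ := hstep i M hM.symm
      refine le_trans (Nat.le_of_mul_le_mul_right (c := i + 1) ?_ (by omega)) (ih (by omega))
      rw [h1, h2]
      exact Nat.mul_le_mul_left _ (Nat.mul_le_mul (by omega) (by omega))

/-- The χ + 1 binomial probabilities with parameter a/χ add up to 1, and the one at the mode a is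
the largest. -/
theorem one_le_mul_choose_mul_pow {χ a : ℕ} (ha : a ≤ χ) (hχ : 0 < χ) :
    1 ≤ ((χ : ℝ) + 1) * (χ.choose a * ((a : ℝ) / χ) ^ a * (1 - (a : ℝ) / χ) ^ (χ - a)) := by
  obtain ⟨l, rfl⟩ := Nat.exists_eq_add_of_le ha
  have hχ' : (0 : ℝ) < ((a + l : ℕ) : ℝ) := by exact_mod_cast hχ
  have hsum : (a + l) ^ (a + l) ≤ (a + l + 1) * ((a + l).choose a * a ^ a * l ^ l) := by
    rw [add_pow]
    refine (Finset.sum_le_card_nsmul _ _ ((a + l).choose a * a ^ a * l ^ l) fun j hj => ?_).trans_eq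
      (by rw [Finset.card_range, smul_eq_mul])
    refine le_trans (le_of_eq (by push_cast; ring))
      (choose_mul_pow_mul_pow_le_mode a l (Nat.lt_succ_iff.1 (Finset.mem_range.1 hj)))
  have hsum' : ((a + l : ℕ) : ℝ) ^ (a + l)
      ≤ (((a + l : ℕ) : ℝ) + 1) * ((a + l).choose a * (a : ℝ) ^ a * (l : ℝ) ^ l) := by
    exact_mod_cast hsum
  have hq : 1 - (a : ℝ) / ((a + l : ℕ) : ℝ) = l / ((a + l : ℕ) : ℝ) := by
    field_simp; push_cast; ring
  rw [hq, Nat.add_sub_cancel_left, div_pow, div_pow]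
  have : (((a + l : ℕ) : ℝ) + 1) * ((a + l).choose a * ((a : ℝ) ^ a / ((a + l : ℕ) : ℝ) ^ a)
      * ((l : ℝ) ^ l / ((a + l : ℕ) : ℝ) ^ l))
      = (((a + l : ℕ) : ℝ) + 1) * ((a + l).choose a * (a : ℝ) ^ a * (l : ℝ) ^ l)
        / ((a + l : ℕ) : ℝ) ^ (a + l) := by
    rw [pow_add]; field_simp
  rw [this, one_le_div (by positivity)]
  exact hsum'

theorem div_pow_le_choose : ∀ {N k : ℕ}, k ≤ N → ((N : ℝ) / k) ^ k ≤ N.choose k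
  | _, 0, _ => by simp
  | 0, _ + 1, h => by omega
  | N + 1, k + 1, h => by
    have hk : k ≤ N := by omega
    have ih := div_pow_le_choose hk
    have hid : ((N + 1).choose (k + 1) : ℝ) = ((N + 1 : ℕ) : ℝ) / (k + 1 : ℕ) * N.choose k := by
      have := Nat.add_one_mul_choose_eq N k
      have h' : ((N + 1 : ℕ) : ℝ) * N.choose k = (N + 1).choose (k + 1) * (k + 1 : ℕ) := by
        exact_mod_cast this
      have : ((k + 1 : ℕ) : ℝ) ≠ 0 := by positivity
      field_simp
      linarith
    rw [pow_succ', hid]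
    refine mul_le_mul_of_nonneg_left (le_trans ?_ ih) (by positivity)
    rcases k.eq_zero_or_pos with rfl | hpos
    · simp
    · have hk' : (0 : ℝ) < k := by exact_mod_cast hpos
      have hkN : (k : ℝ) ≤ N := by exact_mod_cast hk
      refine pow_le_pow_left₀ (by positivity) ?_ _
      rw [div_le_div_iff₀ (by positivity) hk']
      push_cast
      nlinarith

theorem choose_mul_choose_le (a b c d : ℕ) :
    a.choose b * c.choose d ≤ (a + c).choose (b + d) := by
  rw [Nat.add_choose_eq]
  exact Finset.single_le_sum (f := fun ij : ℕ × ℕ => a.choose ij.1 * c.choose ij.2)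
    (fun _ _ => Nat.zero_le _) (Finset.HasAntidiagonal.mem_antidiagonal.2 (rfl : (b, d).1 + (b, d).2 = b + d))

/-- Two applications of Vandermonde bound the cube of χ choose a by 3χ choose 3a. -/
theorem choose_div_choose_three_mul_le {χ a : ℕ} (ha : a ≤ χ) :
    (χ.choose a : ℝ) / (3 * χ).choose (3 * a) ≤ 1 / (χ.choose a : ℝ) ^ 2 := by
  have h1 := choose_mul_choose_le χ a χ a
  have h2 := choose_mul_choose_le (χ + χ) (a + a) χ a
  have h3 : χ.choose a ^ 3 ≤ (3 * χ).choose (3 * a) := by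
    rw [show 3 * χ = χ + χ + χ by ring, show 3 * a = a + a + a by ring]
    calc χ.choose a ^ 3 = χ.choose a * χ.choose a * χ.choose a := by ring
      _ ≤ _ := (Nat.mul_le_mul_right _ h1).trans h2
  have hpos : (0 : ℝ) < χ.choose a := by exact_mod_cast Nat.choose_pos ha
  have hpos' : (0 : ℝ) < (3 * χ).choose (3 * a) := by exact_mod_cast Nat.choose_pos (by omega)
  rw [div_le_div_iff₀ hpos' (by positivity)]
  have h3' : (χ.choose a : ℝ) ^ 3 ≤ (3 * χ).choose (3 * a) := by exact_mod_cast h3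
  nlinarith

end Binomials

/-! ### Bounds for the expected number of sparse cuts -/

section Estimates

/-- The bound for the expected number of sets of `a` interior vertices with `b` half-edges glued to
the boundary, `e` half-edges glued to other interior vertices and `t` inner edges. -/
noncomputable def cutBound (χ n m a b e t : ℕ) : ℝ :=
  (χ.choose a : ℝ) * n.choose b * m.choose t * (3 * χ).choose e / (3 * χ).choose (3 * a)

theorem cutBound_nonneg (χ n m a b e t : ℕ) : 0 ≤ cutBound χ n m a b e t := by
  unfold cutBound; positivity

theorem cutBound_le (χ n m a b e t : ℕ) (ha : a ≤ χ) : cutBound χ n m a b e t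
    ≤ 1 / (χ.choose a : ℝ) ^ 2 * (n.choose b * m.choose t * (3 * χ).choose e) := by
  calc cutBound χ n m a b e t = (χ.choose a : ℝ) / (3 * χ).choose (3 * a)
        * (n.choose b * m.choose t * (3 * χ).choose e) := by rw [cutBound]; ring
    _ ≤ _ := mul_le_mul_of_nonneg_right (choose_div_choose_three_mul_le ha) (by positivity)

/-- With x = a/χ and y = x(n/a)², the square of the bound is at most a constant to the power a times
x^(a-e) y^b. The conditions 30e ≤ a and b ≤ 2a then compare its sixth power with (x⁵(1 + y)¹²)^a,
which is why twelfth powers are taken. -/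
theorem cutBound_pow_le_of_small {χ n m a b e t : ℕ} (hm : 2 * m + n = 3 * χ)
    (ht : 2 * t + b + e = 3 * a) (ha : 1 ≤ a) (haχ : a ≤ χ) (hb : b ≤ 2 * a) (he : 30 * e ≤ a)
    (hn : n ^ 3 ≤ χ ^ 2) :
    cutBound χ n m a b e t ^ 12 ≤ (648 ^ 12 * (((a : ℝ) / χ) ^ 5 + 1 / χ)) ^ a := by
  have haR : (1 : ℝ) ≤ a := by exact_mod_cast ha
  have ha0 : (0 : ℝ) < a := by linarith
  have hχ0 : (0 : ℝ) < χ := by exact_mod_cast (by omega : 0 < χ)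
  set x : ℝ := (a : ℝ) / χ with hx
  have hx0 : 0 < x := by positivity
  have hx1 : x ≤ 1 := (div_le_one hχ0).2 (by exact_mod_cast haχ)
  have hexp : Real.exp a ≤ 3 ^ a := by
    rw [← mul_one (a : ℝ), Real.exp_nat_mul]
    exact pow_le_pow_left₀ (Real.exp_pos 1).le Real.exp_one_lt_three.le _
  have h0 : 1 / (χ.choose a : ℝ) ^ 2 ≤ x ^ (2 * a) := by
    have h := div_pow_le_choose haχ
    have hpos : 0 < ((χ : ℝ) / a) ^ a := by positivity
    calc 1 / (χ.choose a : ℝ) ^ 2 ≤ 1 / (((χ : ℝ) / a) ^ a) ^ 2 := by gcongr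
      _ = x ^ (2 * a) := by
        rw [hx, ← inv_div (χ : ℝ) a, inv_pow, mul_comm 2 a, pow_mul, one_div]
  have h1 : (n.choose b : ℝ) ≤ ((n : ℝ) / a) ^ b * 3 ^ a :=
    (choose_le_pow_mul_exp n b ha0).trans (by gcongr)
  have h2 : (m.choose t : ℝ) ≤ x⁻¹ ^ t * 12 ^ a := by
    calc (m.choose t : ℝ) ≤ ((m : ℝ) / a) ^ t * Real.exp a := choose_le_pow_mul_exp m t ha0
      _ ≤ (2 * x⁻¹) ^ t * 3 ^ a := by
        have : (m : ℝ) ≤ 2 * χ := by exact_mod_cast (by omega : m ≤ 2 * χ)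
        gcongr
        rw [hx, inv_div, ← mul_div_assoc]
        gcongr
      _ ≤ x⁻¹ ^ t * 12 ^ a := by
        have : (2 : ℝ) ^ t ≤ 2 ^ (2 * a) := pow_le_pow_right₀ (by norm_num) (by omega)
        rw [mul_pow, show (12 : ℝ) = 2 ^ 2 * 3 by norm_num, mul_pow, ← pow_mul, mul_comm (2 ^ t),
          mul_assoc]
        gcongr
  have h3 : ((3 * χ).choose e : ℝ) ≤ x⁻¹ ^ e * 9 ^ a := by
    calc ((3 * χ).choose e : ℝ) ≤ (((3 * χ : ℕ) : ℝ) / a) ^ e * Real.exp a :=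
          choose_le_pow_mul_exp _ e ha0
      _ ≤ (3 * x⁻¹) ^ e * 3 ^ a := by
        gcongr
        rw [hx, inv_div, ← mul_div_assoc]
        push_cast
        rfl
      _ ≤ x⁻¹ ^ e * 9 ^ a := by
        have : (3 : ℝ) ^ e ≤ 3 ^ a := pow_le_pow_right₀ (by norm_num) (by omega)
        rw [mul_pow, show (9 : ℝ) = 3 * 3 by norm_num, mul_pow, mul_comm (3 ^ e), mul_assoc]
        gcongr
  set y : ℝ := x * ((n : ℝ) / a) ^ 2 with hy
  have hy0 : 0 ≤ y := by positivity
  have hF : cutBound χ n m a b e t ≤ 324 ^ a * (x ^ (2 * a) * ((n : ℝ) / a) ^ b * x⁻¹ ^ (t + e)) := by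
    calc cutBound χ n m a b e t ≤ x ^ (2 * a) * (((n : ℝ) / a) ^ b * 3 ^ a * (x⁻¹ ^ t * 12 ^ a)
          * (x⁻¹ ^ e * 9 ^ a)) := by
          refine (cutBound_le χ n m a b e t haχ).trans ?_
          gcongr
      _ = _ := by
          rw [show (324 : ℝ) = 3 * 12 * 9 by norm_num, mul_pow, mul_pow, pow_add]; ring
  have hsq : (x ^ (2 * a) * ((n : ℝ) / a) ^ b * x⁻¹ ^ (t + e)) ^ 2 = x ^ (a - e) * y ^ b := by
    -- The exponents match because 2t + b + e = 3a.
    have hpow : x ^ (4 * a) = x ^ (2 * (t + e)) * (x ^ (a - e) * x ^ b) := by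
      rw [← pow_add, ← pow_add]; congr 1; omega
    calc (x ^ (2 * a) * ((n : ℝ) / a) ^ b * x⁻¹ ^ (t + e)) ^ 2
        = x ^ (4 * a) * (((n : ℝ) / a) ^ 2) ^ b * x⁻¹ ^ (2 * (t + e)) := by ring
      _ = x ^ (a - e) * y ^ b * (x ^ (2 * (t + e)) * x⁻¹ ^ (2 * (t + e))) := by
          rw [hpow, hy, mul_pow]; ring
      _ = x ^ (a - e) * y ^ b := by
          rw [← mul_pow, mul_inv_cancel₀ hx0.ne', one_pow, mul_one]
  -- Here n³ ≤ χ² enters: n²⁴ ≤ χ¹⁶ leaves 1/(χ a⁷).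
  have hy12 : x ^ 5 * y ^ 12 ≤ 1 / χ := by
    have hnR : (n : ℝ) ^ 3 ≤ (χ : ℝ) ^ 2 := by exact_mod_cast hn
    have hy3 : y ^ 12 ≤ (χ : ℝ) ^ 4 / a ^ 12 := by
      have : y ^ 12 = ((n : ℝ) ^ 3) ^ 8 / (a ^ 12 * χ ^ 12) := by
        rw [hy, hx]; field_simp
      rw [this]
      calc ((n : ℝ) ^ 3) ^ 8 / (a ^ 12 * χ ^ 12) ≤ ((χ : ℝ) ^ 2) ^ 8 / (a ^ 12 * χ ^ 12) := by gcongr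
        _ = _ := by field_simp
    calc x ^ 5 * y ^ 12 ≤ x ^ 5 * ((χ : ℝ) ^ 4 / a ^ 12) := by gcongr
      _ = 1 / χ * (1 / (a : ℝ) ^ 7) := by rw [hx]; field_simp
      _ ≤ 1 / χ * 1 := by
        gcongr
        rw [div_le_one (by positivity)]
        exact one_le_pow₀ haR
      _ = _ := mul_one _
  have hmain : (x ^ (a - e) * y ^ b) ^ 6 ≤ (x ^ 5 * (2 ^ 12 * (1 + y ^ 12))) ^ a := by
    have h4 : (x ^ (a - e)) ^ 6 ≤ (x ^ 5) ^ a := by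
      rw [← pow_mul, ← pow_mul]
      exact pow_le_pow_of_le_one hx0.le hx1 (by omega)
    have h5 : (y ^ b) ^ 6 ≤ (2 ^ 12 * (1 + y ^ 12)) ^ a := by
      calc (y ^ b) ^ 6 ≤ ((1 + y) ^ b) ^ 6 := by gcongr; linarith
        _ = (1 + y) ^ (b * 6) := by rw [pow_mul]
        _ ≤ (1 + y) ^ (12 * a) := pow_le_pow_right₀ (by linarith) (by omega)
        _ = ((1 + y) ^ 12) ^ a := by rw [pow_mul]
        _ ≤ (2 ^ 12 * (1 + y ^ 12)) ^ a := by
          gcongr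
          rcases le_total y 1 with h | h
          · calc (1 + y) ^ 12 ≤ 2 ^ 12 := by gcongr; linarith
              _ ≤ _ := le_mul_of_one_le_right (by norm_num) (by linarith [pow_nonneg hy0 12])
          · calc (1 + y) ^ 12 ≤ (2 * y) ^ 12 := by gcongr; linarith
              _ ≤ _ := by rw [mul_pow]; gcongr; linarith
    rw [mul_pow, mul_pow (x ^ 5)]
    gcongr
  calc cutBound χ n m a b e t ^ 12
      ≤ (324 ^ a * (x ^ (2 * a) * ((n : ℝ) / a) ^ b * x⁻¹ ^ (t + e))) ^ 12 :=
        pow_le_pow_left₀ (cutBound_nonneg _ _ _ _ _ _ _) hF 12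
    _ = (324 ^ 12) ^ a * ((x ^ (2 * a) * ((n : ℝ) / a) ^ b * x⁻¹ ^ (t + e)) ^ 2) ^ 6 := by
        rw [mul_pow, ← pow_mul, ← pow_mul, ← pow_mul, mul_comm a 12]
    _ ≤ (324 ^ 12) ^ a * (x ^ 5 * (2 ^ 12 * (1 + y ^ 12))) ^ a := by
        rw [hsq]; gcongr
    _ = (324 ^ 12 * (x ^ 5 * (2 ^ 12 * (1 + y ^ 12)))) ^ a := by rw [mul_pow (324 ^ 12)]
    _ ≤ (648 ^ 12 * (x ^ 5 + 1 / χ)) ^ a := by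
        gcongr ?_ ^ a
        rw [show (648 : ℝ) ^ 12 = 324 ^ 12 * 2 ^ 12 by norm_num]
        nlinarith

/-- With p = a/χ and q = 1 - p, the coefficient of χ over a is within a factor χ + 1 of 1/(p^a
q^(χ-a)), and that of m over t is at most 1/(p^t q^(m-t)). After squaring the whole bound, a spare
factor q^(χ-a) survives; it beats the cost of the few cut half-edges. -/
theorem cutBound_sq_le_of_large {χ n m a b e t : ℕ} (hm : 2 * m + n = 3 * χ)
    (ht : 2 * t + b + e = 3 * a) (ha : 1 ≤ a) (haχ : 25 * a ≤ 13 * χ) (he : 30 * e ≤ a) :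
    cutBound χ n m a b e t ^ 2 ≤ ((χ : ℝ) + 1) ^ 4 * 4 ^ n * Real.exp (-(2 / 25) * a) := by
  by_cases hbn : n < b
  · rw [cutBound, Nat.choose_eq_zero_of_lt hbn]; simp; positivity
  by_cases hmt : m < t
  · rw [cutBound, Nat.choose_eq_zero_of_lt hmt]; simp; positivity
  have ha0 : (0 : ℝ) < a := by exact_mod_cast ha
  have hχ0 : (0 : ℝ) < χ := by exact_mod_cast (by omega : 0 < χ)
  set p : ℝ := (a : ℝ) / χ with hp
  set q : ℝ := 1 - p with hq
  have hp0 : 0 < p := by positivity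
  have hp52 : p ≤ 13 / 25 := by
    rw [hp, div_le_iff₀ hχ0]
    have : (25 : ℝ) * a ≤ 13 * χ := by exact_mod_cast haχ
    linarith
  have hq48 : 12 / 25 ≤ q := by rw [hq]; linarith
  have hq0 : 0 < q := by linarith
  have hq1 : q ≤ 1 := by rw [hq]; linarith
  have hR : 1 / (χ.choose a : ℝ) ^ 2 ≤ ((χ : ℝ) + 1) ^ 2 * (p ^ a * q ^ (χ - a)) ^ 2 := by
    have h := one_le_mul_choose_mul_pow (χ := χ) (a := a) (by omega) (by omega)
    have hpos : (0 : ℝ) < χ.choose a := by exact_mod_cast Nat.choose_pos (by omega : a ≤ χ)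
    rw [div_le_iff₀ (by positivity), ← mul_pow, ← mul_pow]
    refine one_le_pow₀ (h.trans_eq ?_)
    ring
  have hb2 : (n.choose b : ℝ) ^ 2 ≤ 4 ^ n := by
    have : (n.choose b : ℝ) ≤ 2 ^ n := by exact_mod_cast Nat.choose_le_two_pow n b
    calc (n.choose b : ℝ) ^ 2 ≤ (2 ^ n) ^ 2 := by gcongr
      _ = 4 ^ n := by rw [← pow_mul, mul_comm, pow_mul]; norm_num
  have ht2 : (m.choose t : ℝ) ^ 2 * (p ^ (2 * t) * q ^ (2 * (m - t))) ≤ 1 := by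
    have h := choose_mul_pow_mul_pow_le_one (not_lt.1 hmt) hp0.le hq0.le (by rw [hq]; ring)
    calc (m.choose t : ℝ) ^ 2 * (p ^ (2 * t) * q ^ (2 * (m - t)))
        = ((m.choose t : ℝ) * p ^ t * q ^ (m - t)) ^ 2 := by ring
      _ ≤ 1 := pow_le_one₀ (by positivity) h
  -- The scale a/30 matches e ≤ a/30 and keeps the exponential cost down to exp(a/15).
  have he2 : ((3 * χ).choose e : ℝ) ^ 2 ≤ 8100 ^ e * p⁻¹ ^ (2 * e) * Real.exp (a / 15) := by
    have h := choose_le_pow_mul_exp (3 * χ) e (x := (a : ℝ) / 30) (by positivity)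
    have hbase : ((3 * χ : ℕ) : ℝ) / (a / 30) = 90 * p⁻¹ := by
      rw [hp]; push_cast; field_simp; norm_num
    rw [hbase] at h
    calc ((3 * χ).choose e : ℝ) ^ 2 ≤ ((90 * p⁻¹) ^ e * Real.exp (a / 30)) ^ 2 := by gcongr
      _ = 8100 ^ e * p⁻¹ ^ (2 * e) * Real.exp (a / 15) := by
        have h1 : Real.exp ((a : ℝ) / 15) = Real.exp (a / 30) ^ 2 := by
          rw [← Real.exp_nat_mul]; congr 1; push_cast; ring
        rw [h1, show (8100 : ℝ) = 90 ^ 2 by norm_num, ← pow_mul, mul_pow, mul_pow, mul_pow]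
        ring
  have hppow : p ^ (4 * a) * p⁻¹ ^ (2 * e) ≤ p ^ (2 * t) := by
    have h1 : p ^ (4 * a) = p ^ (2 * t) * (p ^ (a + b - e) * p ^ (2 * e)) := by
      rw [← pow_add, ← pow_add]; congr 1; omega
    calc p ^ (4 * a) * p⁻¹ ^ (2 * e)
        = p ^ (2 * t) * p ^ (a + b - e) * (p ^ (2 * e) * p⁻¹ ^ (2 * e)) := by rw [h1]; ring
      _ = p ^ (2 * t) * p ^ (a + b - e) := by
          rw [← mul_pow, mul_inv_cancel₀ hp0.ne', one_pow, mul_one]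
      _ ≤ p ^ (2 * t) * 1 := by
          gcongr
          exact pow_le_one₀ hp0.le (by linarith)
      _ = _ := mul_one _
  have hqpow : q ^ (4 * (χ - a)) ≤ q ^ (2 * (m - t)) * q ^ (χ - a) * q⁻¹ ^ e := by
    have h1 : q ^ (4 * (χ - a)) * q ^ e = q ^ (2 * (m - t)) * q ^ (χ - a) * q ^ (n - b) := by
      rw [← pow_add, ← pow_add, ← pow_add]; congr 1; omega
    calc q ^ (4 * (χ - a)) = q ^ (4 * (χ - a)) * q ^ e * q⁻¹ ^ e := by
          rw [mul_assoc, ← mul_pow, mul_inv_cancel₀ hq0.ne', one_pow, mul_one]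
      _ = q ^ (2 * (m - t)) * q ^ (χ - a) * q⁻¹ ^ e * q ^ (n - b) := by rw [h1]; ring
      _ ≤ q ^ (2 * (m - t)) * q ^ (χ - a) * q⁻¹ ^ e * 1 := by
          gcongr
          exact pow_le_one₀ hq0.le hq1
      _ = _ := mul_one _
  have hqexp : q ^ (χ - a) ≤ Real.exp (-(12 / 25) * a) := by
    calc q ^ (χ - a) ≤ Real.exp (-p) ^ (χ - a) := by
          gcongr
          have := Real.add_one_le_exp (-p)
          rw [hq]; linarith
      _ = Real.exp (-(q * a)) := by
          rw [← Real.exp_nat_mul, Nat.cast_sub (by omega)]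
          congr 1
          rw [hq, hp]; field_simp
      _ ≤ Real.exp (-(12 / 25) * a) := by
          rw [Real.exp_le_exp]; nlinarith
  -- Since 8100 · 25/12 = 16875 < 18000 ≤ exp 10 and 10e ≤ a/3. The total exponent is then -12/25 +
  -- 1/3 + 1/15 = -2/25.
  have hconst : 8100 ^ e * q⁻¹ ^ e ≤ Real.exp (a / 3) := by
    have hq' : q⁻¹ ≤ 25 / 12 := by
      rw [inv_le_comm₀ hq0 (by norm_num)]; linarith
    have hten : (18000 : ℝ) ≤ Real.exp 10 := by
      have h1 : (2.7 : ℝ) < Real.exp 1 := lt_trans (by norm_num) Real.exp_one_gt_d9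
      have h2 : Real.exp 10 = Real.exp 1 ^ 10 := by rw [← Real.exp_nat_mul]; norm_num
      rw [h2]
      calc (18000 : ℝ) ≤ 2.7 ^ 10 := by norm_num
        _ ≤ _ := by gcongr
    calc (8100 : ℝ) ^ e * q⁻¹ ^ e ≤ (Real.exp 10) ^ e := by
          rw [← mul_pow]; gcongr; linarith
      _ = Real.exp (10 * e) := by rw [← Real.exp_nat_mul, mul_comm]
      _ ≤ Real.exp (a / 3) := by
          rw [Real.exp_le_exp]
          have : (30 : ℝ) * e ≤ a := by exact_mod_cast he
          linarith
  calc cutBound χ n m a b e t ^ 2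
      ≤ (1 / (χ.choose a : ℝ) ^ 2 * (n.choose b * m.choose t * (3 * χ).choose e)) ^ 2 :=
        pow_le_pow_left₀ (cutBound_nonneg _ _ _ _ _ _ _)
          (cutBound_le χ n m a b e t (by omega)) 2
    _ = (1 / (χ.choose a : ℝ) ^ 2) ^ 2
        * ((n.choose b : ℝ) ^ 2 * (m.choose t : ℝ) ^ 2 * ((3 * χ).choose e : ℝ) ^ 2) := by ring
    _ ≤ (((χ : ℝ) + 1) ^ 2 * (p ^ a * q ^ (χ - a)) ^ 2) ^ 2
        * (4 ^ n * (m.choose t : ℝ) ^ 2 * (8100 ^ e * p⁻¹ ^ (2 * e) * Real.exp (a / 15))) := by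
        gcongr
    _ = ((χ : ℝ) + 1) ^ 4 * 4 ^ n * ((m.choose t : ℝ) ^ 2 * ((p ^ (4 * a) * p⁻¹ ^ (2 * e))
        * q ^ (4 * (χ - a))) * (8100 ^ e * Real.exp (a / 15))) := by ring
    _ ≤ ((χ : ℝ) + 1) ^ 4 * 4 ^ n * ((m.choose t : ℝ) ^ 2 * (p ^ (2 * t)
        * (q ^ (2 * (m - t)) * q ^ (χ - a) * q⁻¹ ^ e)) * (8100 ^ e * Real.exp (a / 15))) := by
        gcongr
    _ = ((χ : ℝ) + 1) ^ 4 * 4 ^ n * (((m.choose t : ℝ) ^ 2 * (p ^ (2 * t) * q ^ (2 * (m - t))))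
        * (q ^ (χ - a) * (8100 ^ e * q⁻¹ ^ e) * Real.exp (a / 15))) := by ring
    _ ≤ ((χ : ℝ) + 1) ^ 4 * 4 ^ n * (1
        * (Real.exp (-(12 / 25) * a) * Real.exp (a / 3) * Real.exp (a / 15))) := by
        gcongr
    _ = ((χ : ℝ) + 1) ^ 4 * 4 ^ n * Real.exp (-(2 / 25) * a) := by
        rw [one_mul, ← Real.exp_add, ← Real.exp_add]
        congr 2
        ring

end Estimates

/-! ### Union bound over all sparse cuts -/

section UnionBound

variable {χ n : ℕ}

theorem prob_or_le (Q R : GoodPartition χ n → Prop) :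
    Prob χ n (fun P => Q P ∨ R P) ≤ Prob χ n Q + Prob χ n R := by
  have h := prob_le_sum (Finset.univ : Finset Bool) (fun P => Q P ∨ R P)
    (fun i => if i then Q else R) (by
      rintro P (hQ | hR)
      · exact ⟨true, Finset.mem_univ _, by simpa using hQ⟩
      · exact ⟨false, Finset.mem_univ _, by simpa using hR⟩)
  simpa using h

/-- Some set of `a` interior vertices has few boundary neighbours and few outgoing edges. -/
def HasSparseCut (a : ℕ) (P : GoodPartition χ n) : Prop :=
  ∃ b e, b ≤ 2 * a ∧ 30 * e ≤ a ∧ HasCut a b e P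

theorem prob_hasSparseCut_le {m a : ℕ} (hm : 2 * m + n = 3 * χ) (ha : a ≤ χ) {C : ℝ} (hC₀ : 0 ≤ C)
    (hC : ∀ b e t, b ≤ 2 * a → 30 * e ≤ a → 2 * t + b + e = 3 * a → cutBound χ n m a b e t ≤ C) :
    Prob χ n (HasSparseCut a) ≤ (2 * a + 1) * (a + 1) * C := by
  refine (prob_le_sum ((Finset.range (2 * a + 1) ×ˢ Finset.range (a + 1)).filter
    fun i => 30 * i.2 ≤ a) _ (fun i => HasCut a i.1 i.2) ?_).trans ?_
  · rintro P ⟨b, e, hb, he, hP⟩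
    refine ⟨(b, e), ?_, hP⟩
    simp only [Finset.mem_filter, Finset.mem_product, Finset.mem_range]
    omega
  · refine (Finset.sum_le_card_nsmul _ _ C fun i hi => ?_).trans ?_
    · simp only [Finset.mem_filter, Finset.mem_product, Finset.mem_range] at hi
      exact prob_hasCut_le hm ha hC₀ fun t ht => hC _ _ t (by omega) hi.2 ht
    · rw [nsmul_eq_mul]
      refine mul_le_mul_of_nonneg_right ?_ hC₀
      have := Finset.card_filter_le (Finset.range (2 * a + 1) ×ˢ Finset.range (a + 1))
        fun i => 30 * i.2 ≤ a
      rw [Finset.card_product, Finset.card_range, Finset.card_range] at this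
      exact_mod_cast this

/-- By pigeonhole some vertex of A has more than two leaves. Its three half-edges are then all used
up, so its cut is empty. -/
theorem exists_vertex_with_three_leaves (P : GoodPartition χ n) {A : Finset (Fin χ)}
    (hA : 2 * A.card < (leafSet P (halfEdges A)).card) : HasCut 1 3 0 P := by
  classical
  have hsub : leafSet P (halfEdges A) ⊆ A.biUnion fun i => leafSet P (halfEdges {i}) := by
    intro x hx
    rw [mem_leafSet] at hx
    simp only [halfEdges, Finset.mem_product, Finset.mem_univ, and_true] at hx
    refine Finset.mem_biUnion.2 ⟨x.1, hx.1, (mem_leafSet P).2 ⟨?_, hx.2⟩⟩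
    simp [halfEdges]
  have hle := (Finset.card_le_card hsub).trans Finset.card_biUnion_le
  obtain ⟨i, -, hi⟩ : ∃ i ∈ A, 2 < (leafSet P (halfEdges {i})).card := by
    by_contra! hall
    have := Finset.sum_le_card_nsmul A _ 2 hall
    rw [smul_eq_mul] at this
    omega
  have hid := card_eq_leafSet_add_cutSet_add_innerPairs P (halfEdges {i})
  rw [card_halfEdges, Finset.card_singleton] at hid
  exact ⟨{i}, Finset.card_singleton i, by omega, by omega⟩

/-- The base of the exponential bound for small sets. -/
noncomputable def smallBase (χ a : ℕ) : ℝ :=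
  648 * (((a : ℝ) / χ) ^ 5 + 1 / χ) ^ (1 / 12 : ℝ)

theorem smallBase_nonneg (χ a : ℕ) : 0 ≤ smallBase χ a := by
  unfold smallBase; positivity

theorem smallBase_pow (χ a : ℕ) :
    smallBase χ a ^ 12 = 648 ^ 12 * (((a : ℝ) / χ) ^ 5 + 1 / χ) := by
  rw [smallBase, mul_pow, ← Real.rpow_mul_natCast (by positivity)]
  norm_num

theorem prob_hasSparseCut_le_of_small {a : ℕ} (hadm : Admissible χ n) (ha : 1 ≤ a) (haχ : a ≤ χ)
    (hn : n ^ 3 ≤ χ ^ 2) :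
    Prob χ n (HasSparseCut a) ≤ (2 * a + 1) * (a + 1) * smallBase χ a ^ a := by
  obtain ⟨-, hnχ, m, hm⟩ := hadm
  refine prob_hasSparseCut_le (m := m) (by omega) haχ (pow_nonneg (smallBase_nonneg _ _) _)
    fun b e t hb he ht => ?_
  have h := cutBound_pow_le_of_small (m := m) (by omega) ht ha haχ hb he hn
  rw [← smallBase_pow, ← pow_mul, mul_comm 12, pow_mul] at h
  exact (pow_le_pow_iff_left₀ (cutBound_nonneg _ _ _ _ _ _ _)
    (pow_nonneg (smallBase_nonneg _ _) _) (by norm_num)).1 h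

theorem prob_hasSparseCut_le_of_large {a : ℕ} (hadm : Admissible χ n) (ha : 1 ≤ a)
    (haχ : 25 * a ≤ 13 * χ) :
    Prob χ n (HasSparseCut a)
      ≤ (2 * a + 1) * (a + 1) * (((χ : ℝ) + 1) ^ 2 * 2 ^ n * Real.exp (-(1 / 25) * a)) := by
  obtain ⟨-, hnχ, m, hm⟩ := hadm
  refine prob_hasSparseCut_le (m := m) (by omega) (by omega) (by positivity)
    fun b e t hb he ht => ?_
  have h := cutBound_sq_le_of_large (n := n) (m := m) (by omega) ht ha haχ he
  refine (pow_le_pow_iff_left₀ (cutBound_nonneg _ _ _ _ _ _ _) (by positivity)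
    two_ne_zero).1 (h.trans_eq ?_)
  rw [mul_pow, mul_pow, ← pow_mul, ← pow_mul, mul_comm n 2, pow_mul 2, ← Real.exp_nat_mul]
  norm_num
  left
  ring

theorem prob_three_leaves_le (hadm : Admissible χ n) :
    Prob χ n (HasCut 1 3 0) ≤ (n : ℝ) ^ 3 / (χ : ℝ) ^ 2 := by
  obtain ⟨hχ, hnχ, m, hm⟩ := hadm
  have hχ0 : (0 : ℝ) < χ := by exact_mod_cast hχ
  refine prob_hasCut_le (m := m) (by omega) hχ (by positivity) fun t ht => ?_
  obtain rfl : t = 0 := by omega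
  have h1 : (χ : ℝ) ^ 3 ≤ (3 * χ).choose (3 * 1) := by
    have h := div_pow_le_choose (show 3 ≤ 3 * χ by omega)
    have h2 : ((3 * χ : ℕ) : ℝ) / (3 : ℕ) = χ := by push_cast; field_simp
    rwa [h2] at h
  have h2 : (n.choose 3 : ℝ) ≤ (n : ℝ) ^ 3 := by exact_mod_cast Nat.choose_le_pow n 3
  simp only [Nat.choose_one_right, Nat.choose_zero_right, Nat.cast_one, mul_one] at h1 ⊢
  calc (χ : ℝ) * n.choose 3 / (3 * χ).choose 3 ≤ χ * (n : ℝ) ^ 3 / (χ : ℝ) ^ 3 := by gcongr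
    _ = _ := by field_simp

/-- The contribution of the sets of `a` vertices, for `a` at most a small multiple of `χ`. -/
noncomputable def smallTerm (δ : ℝ) (χ a : ℕ) : ℝ :=
  if 1 ≤ a ∧ (a : ℝ) ≤ δ * χ then (2 * a + 1) * (a + 1) * smallBase χ a ^ a else 0

theorem smallTerm_nonneg (δ : ℝ) (χ a : ℕ) : 0 ≤ smallTerm δ χ a := by
  have := smallBase_nonneg χ a
  unfold smallTerm; split_ifs <;> positivity

/-- The bound for the contribution of the sets of linear size. -/
noncomputable def largeTerm (δ : ℝ) (χ n : ℕ) : ℝ :=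
  (2 * χ + 1) * (χ + 1) ^ 3 * 2 ^ n * Real.exp (-(1 / 25) * (δ * χ))

theorem one_sub_le_prob (hadm : Admissible χ n) (hn : n ^ 3 ≤ χ ^ 2) (hn' : 25 * n ≤ 3 * χ)
    {δ : ℝ} (hδ : δ ≤ 1) {μ : ℝ} (hμ₀ : 0 ≤ μ) (hμ : μ < 0.02) :
    1 - ((n : ℝ) ^ 3 / (χ : ℝ) ^ 2 + (∑' a, smallTerm δ χ a + χ * largeTerm δ χ n))
      ≤ Prob χ n fun P => IsConnected P ∧ 1 / 18 * μ ^ 2 ≤ lambdaOne P := by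
  obtain ⟨hχ, hnχ, m, hm⟩ := id hadm
  have : Nonempty (GoodPartition χ n) := nonempty_goodPartition (m := m) (by omega)
  set T := (Finset.Icc 1 χ).filter fun a => 6 * a ≤ 3 * χ + n with hT
  set R : GoodPartition χ n → Prop := fun P => HasCut 1 3 0 P ∨ ∃ a ∈ T, HasSparseCut a P with hR
  refine le_trans ?_ (one_sub_prob_le _ R fun P hP => ?_)
  · refine sub_le_sub_left ((prob_or_le _ _).trans (add_le_add (prob_three_leaves_le hadm) ?_)) 1
    have hlarge0 : 0 ≤ largeTerm δ χ n := by unfold largeTerm; positivity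
    have hterm : ∀ a ∈ T, Prob χ n (HasSparseCut a) ≤ smallTerm δ χ a + largeTerm δ χ n := by
      intro a ha
      obtain ⟨ha1, ha6⟩ := Finset.mem_filter.1 ha
      obtain ⟨ha0, haχ⟩ := Finset.mem_Icc.1 ha1
      by_cases hsmall : (a : ℝ) ≤ δ * χ
      · have h := prob_hasSparseCut_le_of_small hadm ha0 haχ hn
        rw [smallTerm, if_pos ⟨ha0, hsmall⟩]
        linarith
      · rw [smallTerm, if_neg fun h => hsmall h.2, zero_add]
        -- From 6a ≤ 3χ + n and 25n ≤ 3χ follows 25a ≤ 13χ.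
        refine (prob_hasSparseCut_le_of_large hadm ha0 (by omega)).trans ?_
        have haχ' : (a : ℝ) ≤ χ := by exact_mod_cast haχ
        calc (2 * (a : ℝ) + 1) * (a + 1) * (((χ : ℝ) + 1) ^ 2 * 2 ^ n * Real.exp (-(1 / 25) * a))
            ≤ (2 * (χ : ℝ) + 1) * (χ + 1)
              * (((χ : ℝ) + 1) ^ 2 * 2 ^ n * Real.exp (-(1 / 25) * (δ * χ))) := by
              have : Real.exp (-(1 / 25) * a) ≤ Real.exp (-(1 / 25) * (δ * χ)) := by
                rw [Real.exp_le_exp]; linarith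
              gcongr
          _ = largeTerm δ χ n := by rw [largeTerm]; ring
    have hTsub : T ⊆ Finset.Icc 1 χ := Finset.filter_subset _ _
    calc Prob χ n (fun P => ∃ a ∈ T, HasSparseCut a P)
        ≤ ∑ a ∈ T, Prob χ n (HasSparseCut a) := prob_le_sum T _ _ fun P hP => hP
      _ ≤ ∑ a ∈ T, (smallTerm δ χ a + largeTerm δ χ n) := Finset.sum_le_sum hterm
      _ ≤ ∑ a ∈ Finset.Icc 1 χ, (smallTerm δ χ a + largeTerm δ χ n) :=
          Finset.sum_le_sum_of_subset_of_nonneg hTsub fun a _ _ =>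
            add_nonneg (smallTerm_nonneg _ _ _) hlarge0
      _ = ∑' a, smallTerm δ χ a + χ * largeTerm δ χ n := by
          rw [Finset.sum_add_distrib, Finset.sum_const, Nat.card_Icc, Nat.add_sub_cancel,
            nsmul_eq_mul, tsum_eq_sum fun a ha => ?_]
          rw [smallTerm, if_neg]
          rintro ⟨h1, h2⟩
          refine ha (Finset.mem_Icc.2 ⟨h1, ?_⟩)
          have : (a : ℝ) ≤ χ := h2.trans (mul_le_of_le_one_left (Nat.cast_nonneg _) hδ)
          exact_mod_cast this
  · simp only [hR, not_or] at hP
    have hexp : Expands (weight P) (1 / 150) := by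
      refine expands_of_forall_cutSet P fun A hA hA6 => ?_
      -- A violation with b ≤ 2a satisfies 150e < 3a + b ≤ 5a, hence 30e < a.
      by_contra! hlt
      by_cases hleaf : 2 * A.card < (leafSet P (halfEdges A)).card
      · exact hP.1 (exists_vertex_with_three_leaves P hleaf)
      · refine hP.2 ⟨A.card, Finset.mem_filter.2 ⟨Finset.mem_Icc.2 ⟨hA.card_pos, ?_⟩, hA6⟩,
          _, _, not_lt.1 hleaf, by omega, A, rfl, rfl, rfl⟩
        simpa using Finset.card_le_univ A
    have h := isConnected_and_le_lambdaOne P (by omega) (by norm_num) hexp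
    refine ⟨h.1, le_trans ?_ h.2⟩
    -- Sharp at the endpoint: 0.02²/18 = (1/150)²/2 = 1/45000.
    nlinarith

end UnionBound

/-! ### Passage to the limit -/

section Limits

theorem tendsto_tsum_smallTerm : ∃ δ : ℝ, 0 < δ ∧ δ ≤ 1 ∧
    Tendsto (fun χ : ℕ => ∑' a, smallTerm δ χ a) atTop (𝓝 0) := by
  -- Chosen so that 648¹² · 2δ = (1/16)¹², making `smallBase` at most 1/16. With the polynomial
  -- factor bounded by 8^a, the summands are dominated by (1/2)^a.
  set δ : ℝ := 1 / (2 * (648 * 16) ^ 12) with hδ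
  have hδ0 : 0 < δ := by positivity
  have hδ1 : δ ≤ 1 := by rw [hδ]; norm_num
  refine ⟨δ, hδ0, hδ1, ?_⟩
  have h := tendsto_tsum_of_dominated_convergence (𝓕 := (atTop : Filter ℕ)) (f := smallTerm δ)
    (g := fun _ => 0) (bound := fun a => (1 / 2 : ℝ) ^ a) summable_geometric_two ?_ ?_
  · simpa using h
  · intro a
    rcases a.eq_zero_or_pos with rfl | ha
    · simp [smallTerm]
    have hbase : Tendsto (fun χ : ℕ => smallBase χ a) atTop (𝓝 0) := by
      have h1 : Tendsto (fun χ : ℕ => ((a : ℝ) / χ) ^ 5 + 1 / χ) atTop (𝓝 0) := by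
        simpa using ((tendsto_const_div_atTop_nhds_zero_nat (a : ℝ)).pow 5).add
          (tendsto_const_div_atTop_nhds_zero_nat (1 : ℝ))
      have h2 := (h1.rpow_const (p := (1 / 12 : ℝ)) (Or.inr (by norm_num))).const_mul 648
      simpa [smallBase, Real.zero_rpow] using h2
    have hpow : Tendsto (fun χ : ℕ => (2 * (a : ℝ) + 1) * (a + 1) * smallBase χ a ^ a) atTop
        (𝓝 0) := by
      have := (hbase.pow a).const_mul ((2 * (a : ℝ) + 1) * (a + 1))
      rwa [zero_pow ha.ne', mul_zero] at this
    refine squeeze_zero (fun χ => smallTerm_nonneg _ _ _) (fun χ => ?_) hpow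
    have := smallBase_nonneg χ a
    unfold smallTerm
    split_ifs
    · rfl
    · positivity
  · filter_upwards [eventually_ge_atTop ⌈1 / δ⌉₊, eventually_gt_atTop 0] with χ hχ hχpos a
    rw [Real.norm_of_nonneg (smallTerm_nonneg _ _ _), smallTerm]
    split_ifs with hcond
    swap
    · positivity
    have hχ0 : (0 : ℝ) < χ := by exact_mod_cast hχpos
    have hinv : 1 / (χ : ℝ) ≤ δ := by
      rw [one_div_le hχ0 hδ0]
      exact (Nat.le_ceil _).trans (by exact_mod_cast hχ)
    have hx : (a : ℝ) / χ ≤ δ := (div_le_iff₀ hχ0).2 hcond.2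
    have hx5 : ((a : ℝ) / χ) ^ 5 ≤ δ :=
      (pow_le_of_le_one (by positivity) (hx.trans hδ1) (by norm_num)).trans hx
    have hbase : smallBase χ a ≤ 1 / 16 := by
      refine (pow_le_pow_iff_left₀ (smallBase_nonneg _ _) (by norm_num)
        (show 12 ≠ 0 by norm_num)).1 ?_
      rw [smallBase_pow]
      calc (648 : ℝ) ^ 12 * (((a : ℝ) / χ) ^ 5 + 1 / χ) ≤ 648 ^ 12 * (δ + δ) := by gcongr
        _ = (1 / 16) ^ 12 := by rw [hδ]; norm_num
    have hpoly : ∀ k : ℕ, (2 * (k : ℝ) + 1) * (k + 1) ≤ 8 ^ k := by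
      intro k
      induction k with
      | zero => norm_num
      | succ k ih =>
        rw [pow_succ]; push_cast
        nlinarith [(Nat.cast_nonneg k : (0 : ℝ) ≤ k)]
    calc (2 * (a : ℝ) + 1) * (a + 1) * smallBase χ a ^ a ≤ 8 ^ a * (1 / 16) ^ a := by
          have := smallBase_nonneg χ a
          gcongr
          exact hpoly a
      _ = (1 / 2) ^ a := by rw [← mul_pow]; norm_num

theorem tendsto_pow_five_mul_exp {c : ℝ} (hc : 0 < c) :
    Tendsto (fun χ : ℕ => 64 * ((χ : ℝ) ^ 5 * Real.exp (-c * χ))) atTop (𝓝 0) := by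
  have h := tendsto_pow_const_mul_const_pow_of_abs_lt_one 5 (r := Real.exp (-c)) (by
    rw [abs_of_pos (Real.exp_pos _), Real.exp_lt_one_iff]; linarith)
  have h' := h.const_mul 64
  rw [mul_zero] at h'
  refine h'.congr fun χ => ?_
  rw [← Real.exp_nat_mul, mul_comm (χ : ℝ) (-c)]

/-- Half of the decay exp(-δχ/25) absorbs 2ⁿ. -/
theorem mul_largeTerm_le {δ : ℝ} {χ n : ℕ} (hχ : 1 ≤ χ) (hn : (n : ℝ) ≤ δ / 50 * χ) :
    χ * largeTerm δ χ n ≤ 64 * ((χ : ℝ) ^ 5 * Real.exp (-(δ / 50) * χ)) := by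
  have hχ1 : (1 : ℝ) ≤ χ := by exact_mod_cast hχ
  have h2 : (2 : ℝ) ^ n ≤ Real.exp (δ / 50 * χ) := by
    calc (2 : ℝ) ^ n ≤ Real.exp 1 ^ n := by
          gcongr
          linarith [Real.add_one_le_exp (1 : ℝ)]
      _ = Real.exp n := by rw [← Real.exp_nat_mul, mul_one]
      _ ≤ _ := Real.exp_le_exp.2 hn
  have hpoly : (χ : ℝ) * ((2 * χ + 1) * (χ + 1) ^ 3) ≤ 64 * (χ : ℝ) ^ 5 := by
    have h3 : (χ : ℝ) + 1 ≤ 2 * χ := by linarith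
    calc (χ : ℝ) * ((2 * χ + 1) * (χ + 1) ^ 3) ≤ χ * ((4 * χ) * (2 * χ) ^ 3) := by
          gcongr
          linarith
      _ = 32 * (χ : ℝ) ^ 5 := by ring
      _ ≤ 64 * (χ : ℝ) ^ 5 := by gcongr; norm_num
  calc χ * largeTerm δ χ n
      = (χ * ((2 * χ + 1) * (χ + 1) ^ 3)) * (2 ^ n * Real.exp (-(1 / 25) * (δ * χ))) := by
        rw [largeTerm]; ring
    _ ≤ (64 * χ ^ 5) * (Real.exp (δ / 50 * χ) * Real.exp (-(1 / 25) * (δ * χ))) := by gcongr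
    _ = 64 * ((χ : ℝ) ^ 5 * Real.exp (-(δ / 50) * χ)) := by
        rw [← Real.exp_add, mul_assoc]; congr 3; ring

theorem admissibleAtTop_le (n : ℕ → ℕ) : admissibleAtTop n ≤ atTop := inf_le_left

theorem eventually_admissible (n : ℕ → ℕ) : ∀ᶠ χ in admissibleAtTop n, Admissible χ (n χ) :=
  mem_inf_of_right (mem_principal_self _)

theorem tendsto_cube_div_sq {l : Filter ℕ} {n : ℕ → ℕ}
    (hn : (fun χ : ℕ => (n χ : ℝ)) =o[l] fun χ : ℕ => (χ : ℝ) ^ (2 / 3 : ℝ)) :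
    Tendsto (fun χ : ℕ => (n χ : ℝ) ^ 3 / (χ : ℝ) ^ 2) l (𝓝 0) := by
  have h := hn.tendsto_div_nhds_zero.pow 3
  rw [zero_pow (by norm_num)] at h
  refine h.congr fun χ => ?_
  rw [div_pow, ← Real.rpow_mul_natCast (Nat.cast_nonneg χ)]
  norm_num

end Limits

end CubicBoundary

theorem theorem1p1 (n : ℕ → ℕ)
    (hn : (fun χ : ℕ => (n χ : ℝ)) =o[CubicBoundary.admissibleAtTop n]
      fun χ : ℕ => (χ : ℝ) ^ (2 / 3 : ℝ))
    (μ : ℝ) (hμ₀ : 0 ≤ μ) (hμ : μ < 0.02) :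
    Tendsto
      (fun χ : ℕ => CubicBoundary.Prob χ (n χ) fun P =>
        CubicBoundary.IsConnected P ∧ 1 / 18 * μ ^ 2 ≤ CubicBoundary.lambdaOne P)
      (CubicBoundary.admissibleAtTop n) (𝓝 1) := by
  obtain ⟨δ, hδ0, hδ1, hsmall⟩ := CubicBoundary.tendsto_tsum_smallTerm
  have hle := CubicBoundary.admissibleAtTop_le n
  have hcube := CubicBoundary.tendsto_cube_div_sq hn
  have hlarge := CubicBoundary.tendsto_pow_five_mul_exp (c := δ / 50) (by positivity)
  have hlow := (hcube.add ((hsmall.mono_left hle).add (hlarge.mono_left hle))).const_sub 1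
  simp only [add_zero, sub_zero] at hlow
  refine tendsto_of_tendsto_of_tendsto_of_le_of_le' hlow tendsto_const_nhds ?_
    (Eventually.of_forall fun χ => CubicBoundary.prob_le_one _)
  -- Once n³ ≤ χ², the threshold χ ≥ (δ/50)⁻³ yields n ≤ δχ/50.
  filter_upwards [CubicBoundary.eventually_admissible n, hcube.eventually_lt_const one_pos,
    hle (eventually_ge_atTop ⌈((δ / 50) ^ 3)⁻¹⌉₊)] with χ hadm hlt hχ
  have hχ0 : (0 : ℝ) < χ := by exact_mod_cast hadm.1
  have hn3 : (n χ : ℝ) ^ 3 ≤ (χ : ℝ) ^ 2 := by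
    rw [div_lt_one (by positivity)] at hlt
    exact hlt.le
  have hnδ : (n χ : ℝ) ≤ δ / 50 * χ := by
    refine (pow_le_pow_iff_left₀ (Nat.cast_nonneg _) (by positivity)
      (show 3 ≠ 0 by norm_num)).1 (hn3.trans ?_)
    have h1 : ((δ / 50) ^ 3)⁻¹ ≤ (χ : ℝ) := (Nat.le_ceil _).trans (by exact_mod_cast hχ)
    have h2 : 1 ≤ (δ / 50) ^ 3 * (χ : ℝ) := by
      rwa [inv_le_iff_one_le_mul₀' (by positivity)] at h1
    calc (χ : ℝ) ^ 2 = 1 * χ ^ 2 := (one_mul _).symm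
      _ ≤ ((δ / 50) ^ 3 * χ) * χ ^ 2 := by gcongr
      _ = (δ / 50 * χ) ^ 3 := by ring
  have hn25 : 25 * n χ ≤ 3 * χ := by
    have : (25 : ℝ) * n χ ≤ 3 * χ := by nlinarith
    exact_mod_cast this
  refine le_trans ?_ (CubicBoundary.one_sub_le_prob hadm (by exact_mod_cast hn3) hn25 hδ1 hμ₀ hμ)
  have := CubicBoundary.mul_largeTerm_le hadm.1 hnδ
  linarith
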